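/- Let $R$ be a commutative ring, $p\in R$ an invertible element, and put $z=p^2$, $q=p^{-3}$ (the generic case is $R=\mathbb Z[p,p^{-1}]$). **The scalars $\Xi(a,b,i,k)$.** Let $\Omega=\mathbb Z/3\mathbb Z=\{1,2,3\}$. For $i\in\Omega$ let $s_i$ be the $R$-algebra automorphism of $R[x_1,x_2,x_3]$ (indices modulo $3$) with $s_i(x_i)=z\,x_{i+1}$, $s_i(x_{i+1})=z^{-1}x_i$, $s_i(x_{i+2})=x_{i+2}$, and let $\partial_i(f)=\dfrac{f-s_i(f)}{x_i-z\,x_{i+1}}$ be the deformed Demazure operator. For $a,b\ge 0$ and $\ell=a+b+1$ let $\partial_{(a,b,i)}$ be the composite of the $\ell$ operators along the expression $$\underline w(a,b,i)=(j-a,\,\dots,\,j-1,\,j,\,j-1,\,\dots,\,i+1,\,i),\qquad j=i+b,$$ (rightmost operator applied first). For $0\le k\le \ell$ the polynomial $\partial_{(a,b,i)}(x_1^kx_2^{\ell-k})$ is a constant, and $\Xi(a,b,i,k)\in R$ denotes this constant. **Quantum numbers.** For $n\in\mathbb Z$ let $[n]=\frac{q^n-q^{-n}}{q-q^{-1}}$,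 and for $m\in\mathbb Z$, $j\ge 0$ let ${m \brack j}=\frac{[m][m-1]\cdots[m-j+1]}{[j][j-1]\cdots[1]}$ (all read as Laurent polynomials in $q$). Let $\rho'(d)=\prod_{c=1}^d(1-q^{-2c})$ and $$\mathrm{magic}(\nu,k,\beta,\varepsilon)=\sum_{j=0}^{\beta} q^{\,j(2k-3\nu-2\varepsilon)}{k-1 \brack \beta-j}{\nu-1-k \brack j}.$$ **Theorem.** Let $a,b>0$, $i\in\Omega$ and $0<k<\ell=a+b+1$. Define $\alpha,\beta\ge 0$ by $a\in\{2\alpha+1,2\alpha+2\}$ and $b\in\{2\beta+1,2\beta+2\}$, let $\nu=\alpha+\beta+2$, and let $\phi$ be the number of even entries of the pair $(a,b)$. Then $$\Xi(a,b,i,k)=\mu\,\gamma_1\gamma_2\gamma_3\,\kappa_1\kappa_2\,\lambda_1\lambda_2\lambda_3\lambda_4\lambda_5,$$ where $\mu=(-1)^{\beta+k}$, $\gamma_1=\rho'(\alpha)\rho'(\beta)$, $$\gamma_2=\begin{cases} 1 & a,b\text{ odd}\\ q^{-\nu}(q-q^{-1})[k-\nu] & a\text{ even},\ b\text{ odd}\\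 q^{-\nu}(q-q^{-1})[\nu-k] & a\text{ odd},\ b\text{ even},\ i=1\\ q^{-(\ell-1)}(q-q^{-1})[\ell-1-k] & a\text{ odd},\ b\text{ even},\ i=2\\ q^{-(\ell-1)}(q-q^{-1})[1-k] & a\text{ odd},\ b\text{ even},\ i=3\\ q^{-\ell}(q-q^{-1})^2[k-\nu][\nu+1-k] & a,b\text{ even},\ i=1\\ q^{-(\ell+\nu-1)}(q-q^{-1})^2[k-\nu][\ell-1-k] & a,b\text{ even},\ i=2\\ q^{-(\ell+\nu-1)}(q-q^{-1})^2[k-1][\nu+1-k] & a,b\text{ even},\ i=3, \end{cases}$$ $$\gamma_3=\begin{cases} \mathrm{magic}(\nu,k,\beta,-1) & a,b\text{ odd}\\ \mathrm{magic}(\nu,k,\beta,0) & a\text{ even},\ b\text{ odd}\\ \mathrm{magic}(\nu,k,\beta,0) & a\text{ odd},\ b\text{ even},\ i=1\\ \mathrm{magic}(\nu,k,\beta,-1) & a\text{ odd},\ b\text{ even},\ i=2\\ q^{\beta}\,\mathrm{magic}(\nu,k-1,\beta,-1) & a\text{ odd},\ b\text{ even},\ i=3\\ \mathrm{magic}(\nu,k,\beta,1)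 & a,b\text{ even},\ i=1\\ \mathrm{magic}(\nu,k,\beta,0) & a,b\text{ even},\ i=2\\ q^{\beta}\,\mathrm{magic}(\nu,k-1,\beta,0) & a,b\text{ even},\ i=3, \end{cases}$$ $$\kappa_1=z^kq^{k(k-\beta-\ell)},\qquad \kappa_2=\begin{cases}q^{2k}& i=2\\ 1& i\ne 2,\end{cases}\qquad \lambda_1=z^{\binom{\beta}{2}}z^{-\binom{\ell+1}{2}}p^{-(\beta+1)(\ell+3\beta)},$$ $$\lambda_2=\begin{cases}z^{\beta}& a\text{ odd}\\ z^{-\beta-3}& a\text{ even},\end{cases}\qquad \lambda_3=\begin{cases}z^{\ell+1}& b\text{ odd}\\ 1& b\text{ even},\end{cases}\qquad \lambda_4=p^{(\beta+3)(\phi-1)},\qquad \lambda_5=\begin{cases}1& i=1\\ z^{\ell}& i=2\\ z^{-\ell}& i=3.\end{cases}$$ -/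

import Mathlib

/-! ### Quantum numbers at an invertible parameter `q` -/

section QuantumNumbers

variable {R : Type*} [CommRing R]

/-- The quantum integer `[n] = (q ^ n - q ^ (-n)) / (q - q⁻¹)` for `n : ℤ`, written out as the
Laurent polynomial `q ^ (n - 1) + q ^ (n - 3) + ⋯ + q ^ (1 - n)` for `n ≥ 0`, with `[-n] = -[n]`. -/
def quantumInt (q : Rˣ) (n : ℤ) : R :=
  (n.sign : R) * ∑ t ∈ Finset.range n.natAbs, ((q ^ ((n.natAbs : ℤ) - 1 - 2 * (t : ℤ)) : Rˣ) : R)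

/-- The quantum factorial `[n]! = [1][2]⋯[n]`. -/
def quantumFactorial (q : Rˣ) (n : ℕ) : R :=
  ∏ t ∈ Finset.range n, quantumInt q ((t : ℤ) + 1)

/-- The balanced quantum binomial coefficient for `n : ℕ`, by the quantum Pascal rule. -/
def quantumChooseNat (q : Rˣ) : ℕ → ℕ → R
  | _, 0 => 1
  | 0, _ + 1 => 0
  | n + 1, j + 1 =>
      ((q ^ ((j : ℤ) + 1) : Rˣ) : R) * quantumChooseNat q n (j + 1) +
        ((q ^ ((j : ℤ) - (n : ℤ)) : Rˣ) : R) * quantumChooseNat q n j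

/-- The balanced quantum binomial coefficient `[m] [m - 1] ⋯ [m - j + 1] / [j]!` for an arbitrary
integer `m`; the defining property is `quantumFactorial_mul_quantumChoose` below. -/
def quantumChoose (q : Rˣ) : ℤ → ℕ → R
  | Int.ofNat n, j => quantumChooseNat q n j
  | Int.negSucc n, j => (-1) ^ j * quantumChooseNat q (n + j) j

theorem quantumInt_natCast (q : Rˣ) (n : ℕ) :
    quantumInt q (n : ℤ) =
      ∑ t ∈ Finset.range n, ((q ^ ((n : ℤ) - 1 - 2 * (t : ℤ)) : Rˣ) : R) := by
  unfold quantumInt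
  rcases Nat.eq_zero_or_pos n with rfl | hn
  · simp
  · have : ((n : ℤ)).sign = 1 := Int.sign_eq_one_of_pos (by exact_mod_cast hn)
    simp [this]

theorem quantumInt_neg (q : Rˣ) (n : ℤ) : quantumInt q (-n) = -quantumInt q n := by
  simp [quantumInt]

theorem quantumInt_natCast_succ (q : Rˣ) (n : ℕ) :
    quantumInt q ((n : ℤ) + 1) = (q : R) * quantumInt q (n : ℤ) + ((q ^ (-(n : ℤ)) : Rˣ) : R) := by
  have h := quantumInt_natCast q (n + 1)
  push_cast at h
  rw [h, quantumInt_natCast, Finset.sum_range_succ, Finset.mul_sum]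
  congr 1
  · refine Finset.sum_congr rfl fun t _ => ?_
    rw [← Units.val_mul, ← zpow_one_add]
    congr 2
    ring
  · congr 2
    ring

theorem quantumInt_natCast_succ' (q : Rˣ) (n : ℕ) :
    quantumInt q ((n : ℤ) + 1) =
      ((q⁻¹ : Rˣ) : R) * quantumInt q (n : ℤ) + ((q ^ (n : ℤ) : Rˣ) : R) := by
  have h := quantumInt_natCast q (n + 1)
  push_cast at h
  rw [h, quantumInt_natCast, Finset.sum_range_succ', Finset.mul_sum]
  congr 1
  · refine Finset.sum_congr rfl fun t _ => ?_
    rw [← Units.val_mul, ← zpow_neg_one, ← zpow_add]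
    congr 2
    push_cast
    ring
  · congr 2
    push_cast
    ring

theorem quantumInt_succ (q : Rˣ) (n : ℤ) :
    quantumInt q (n + 1) = (q : R) * quantumInt q n + ((q ^ (-n) : Rˣ) : R) := by
  obtain ⟨m, rfl | rfl⟩ := n.eq_nat_or_neg
  · exact quantumInt_natCast_succ q m
  · rcases m with _ | m
    · simpa using quantumInt_natCast_succ q 0
    · have e : (-((m + 1 : ℕ) : ℤ) + 1) = -(m : ℤ) := by push_cast; ring
      have e2 : (((m + 1 : ℕ)) : ℤ) = (m : ℤ) + 1 := by push_cast; ring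
      rw [e, quantumInt_neg, quantumInt_neg, e2, quantumInt_natCast_succ', neg_neg, zpow_add_one,
        Units.val_mul]
      have : (q : R) * ((q⁻¹ : Rˣ) : R) = 1 := by simp
      linear_combination (quantumInt q (m : ℤ)) * this

/-- `(q - q⁻¹) [n] = q ^ n - q ^ (-n)`. -/
theorem sub_inv_mul_quantumInt (q : Rˣ) (n : ℤ) :
    ((q : R) - ((q⁻¹ : Rˣ) : R)) * quantumInt q n =
      ((q ^ n : Rˣ) : R) - ((q ^ (-n) : Rˣ) : R) := by
  have key : ∀ m : ℕ, ((q : R) - ((q⁻¹ : Rˣ) : R)) * quantumInt q (m : ℤ) =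
      ((q ^ (m : ℤ) : Rˣ) : R) - ((q ^ (-(m : ℤ)) : Rˣ) : R) := by
    intro m
    have h1 := quantumInt_natCast_succ q m
    have h2 := quantumInt_natCast_succ' q m
    linear_combination h2 - h1
  obtain ⟨m, rfl | rfl⟩ := n.eq_nat_or_neg
  · exact key m
  · rw [quantumInt_neg, neg_neg]
    linear_combination -key m

theorem quantumInt_add (q : Rˣ) (m n : ℤ) :
    quantumInt q (m + n) =
      ((q ^ n : Rˣ) : R) * quantumInt q m + ((q ^ (-m) : Rˣ) : R) * quantumInt q n := by
  induction n using Int.induction_on with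
  | zero => simp [quantumInt]
  | succ n ih =>
    rw [← add_assoc, quantumInt_succ, ih, quantumInt_succ q (n : ℤ), zpow_add_one, neg_add,
      zpow_add, Units.val_mul, Units.val_mul]
    ring
  | pred n ih =>
    have h1 := quantumInt_succ q (m + (-(n : ℤ) - 1))
    have h2 := quantumInt_succ q (-(n : ℤ) - 1)
    rw [show m + (-(n : ℤ) - 1) + 1 = m + -(n : ℤ) by ring, ih,
      show -(m + (-(n : ℤ) - 1)) = -m + -(-(n : ℤ) - 1) by ring, zpow_add] at h1
    rw [show -(n : ℤ) - 1 + 1 = -(n : ℤ) by ring] at h2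
    have h3 : ((q ^ (-(n : ℤ)) : Rˣ) : R) = (q : R) * ((q ^ (-(n : ℤ) - 1) : Rˣ) : R) := by
      rw [← Units.val_mul, ← zpow_one_add]
      congr 2
      ring
    rw [h2, h3, Units.val_mul] at h1
    have h4 : (q : R) * quantumInt q (m + (-(n : ℤ) - 1)) =
        (q : R) * (((q ^ (-(n : ℤ) - 1) : Rˣ) : R) * quantumInt q m +
          ((q ^ (-m) : Rˣ) : R) * quantumInt q (-(n : ℤ) - 1)) := by
      linear_combination -h1
    exact q.isUnit.mul_left_cancel h4

theorem quantumFactorial_mul_quantumChooseNat (q : Rˣ) (n j : ℕ) :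
    quantumFactorial q j * quantumChooseNat q n j =
      ∏ t ∈ Finset.range j, quantumInt q ((n : ℤ) - t) := by
  induction n generalizing j with
  | zero =>
    rcases j with _ | j
    · simp [quantumFactorial, quantumChooseNat]
    · rw [Finset.prod_eq_zero (i := 0) (by simp) (by simp [quantumInt])]
      simp [quantumChooseNat]
  | succ n ih =>
    rcases j with _ | j
    · simp [quantumFactorial, quantumChooseNat]
    · have h1 := ih (j + 1)
      have h2 := ih j
      have hf : quantumFactorial q (j + 1) = quantumFactorial q j * quantumInt q ((j : ℤ) + 1) := by
        simp [quantumFactorial, Finset.prod_range_succ]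
      rw [Finset.prod_range_succ] at h1
      rw [Finset.prod_range_succ']
      have e : ∀ t ∈ Finset.range j, quantumInt q (((n + 1 : ℕ) : ℤ) - ((t + 1 : ℕ) : ℤ)) =
          quantumInt q ((n : ℤ) - t) := by
        intro t _
        congr 1
        push_cast
        ring
      rw [Finset.prod_congr rfl e]
      have hadd := quantumInt_add q ((n : ℤ) - j) ((j : ℤ) + 1)
      rw [show (n : ℤ) - j + (j + 1) = ((n + 1 : ℕ) : ℤ) - ((0 : ℕ) : ℤ) by push_cast; ring,
        neg_sub] at hadd
      rw [hadd, quantumChooseNat]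
      rw [hf] at h1 ⊢
      linear_combination ((q ^ ((j : ℤ) + 1) : Rˣ) : R) * h1 +
        ((q ^ ((j : ℤ) - (n : ℤ)) : Rˣ) : R) * quantumInt q ((j : ℤ) + 1) * h2

/-- `[j]!` times the quantum binomial coefficient is `[m] [m - 1] ⋯ [m - j + 1]`. -/
theorem quantumFactorial_mul_quantumChoose (q : Rˣ) (m : ℤ) (j : ℕ) :
    quantumFactorial q j * quantumChoose q m j =
      ∏ t ∈ Finset.range j, quantumInt q (m - t) := by
  rcases m with n | n
  · exact quantumFactorial_mul_quantumChooseNat q n j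
  · have h := quantumFactorial_mul_quantumChooseNat q (n + j) j
    have e : ∀ t ∈ Finset.range j, quantumInt q (Int.negSucc n - (t : ℤ)) =
        (-1) * quantumInt q (((n + j : ℕ) : ℤ) - ((j - 1 - t : ℕ) : ℤ)) := by
      intro t ht
      rw [neg_one_mul, ← quantumInt_neg]
      congr 1
      have := Finset.mem_range.1 ht
      rw [Int.negSucc_eq]
      omega
    rw [Finset.prod_congr rfl e, Finset.prod_mul_distrib, Finset.prod_const, Finset.card_range,
      Finset.prod_range_reflect (fun t => quantumInt q (((n + j : ℕ) : ℤ) - (t : ℤ))) j, ← h]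
    simp only [quantumChoose]
    ring

end QuantumNumbers

/-! ### The deformed Demazure operators

The variables `x₁, x₂, x₃` and the simple reflections `s₁, s₂, s₃` are indexed by `ZMod 3`,
so that `x₃ = x₀`, and the parameter `z` is invertible. -/

section Demazure

open MvPolynomial

variable {R : Type*} [CommRing R]

/-- The simple reflection `s_i` of the deformed affine Weyl group: the algebra automorphism with
`x_i ↦ z x_{i+1}`, `x_{i+1} ↦ z⁻¹ x_i`, fixing the third variable. -/
noncomputable def deformedReflection (z : Rˣ) (i : ZMod 3) :
    MvPolynomial (ZMod 3) R →ₐ[R] MvPolynomial (ZMod 3) R :=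
  aeval fun j =>
    if j = i then C (z : R) * X (i + 1)
    else if j = i + 1 then C ((z⁻¹ : Rˣ) : R) * X i
    else X j

/-- The simple root `x_i - z x_{i+1}`. -/
noncomputable def deformedRoot (z : Rˣ) (i : ZMod 3) : MvPolynomial (ZMod 3) R :=
  X i - C (z : R) * X (i + 1)

theorem deformedRoot_dvd (z : Rˣ) (i : ZMod 3) (f : MvPolynomial (ZMod 3) R) :
    ∃ g, deformedRoot z i * g = f - deformedReflection z i f := by
  suffices h : deformedRoot z i ∣ f - deformedReflection z i f by
    obtain ⟨g, hg⟩ := h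
    exact ⟨g, hg.symm⟩
  induction f using MvPolynomial.induction_on with
  | C r => simp [deformedReflection]
  | add f g hf hg =>
    rw [map_add, add_sub_add_comm]
    exact dvd_add hf hg
  | mul_X f n hf =>
    have hn : deformedRoot z i ∣ X n - deformedReflection z i (X n) := by
      simp only [deformedReflection, aeval_X]
      split_ifs with h1 h2
      · subst h1; exact dvd_rfl
      · subst h2
        refine ⟨-C ((z⁻¹ : Rˣ) : R), ?_⟩
        have : (C (z : R) : MvPolynomial (ZMod 3) R) * C ((z⁻¹ : Rˣ) : R) = 1 := by
          rw [← C_mul]; simp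
        rw [deformedRoot]
        linear_combination -(X (i + 1)) * this
      · simp
    have e : f * X n - deformedReflection z i (f * X n) =
        (f - deformedReflection z i f) * X n +
          deformedReflection z i f * (X n - deformedReflection z i (X n)) := by
      rw [map_mul]; ring
    rw [e]
    exact dvd_add (hf.mul_right _) (hn.mul_left _)

/-- The deformed Demazure operator `∂_i f = (f - s_i f) / (x_i - z x_{i+1})`. The quotient exists
by `deformedRoot_dvd` and is unique by `deformedRoot_mul_cancel`. -/
noncomputable def demazure (z : Rˣ) (i : ZMod 3) (f : MvPolynomial (ZMod 3) R) :
    MvPolynomial (ZMod 3) R :=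
  Classical.choose (deformedRoot_dvd z i f)

theorem deformedRoot_mul_demazure (z : Rˣ) (i : ZMod 3) (f : MvPolynomial (ZMod 3) R) :
    deformedRoot z i * demazure z i f = f - deformedReflection z i f :=
  Classical.choose_spec (deformedRoot_dvd z i f)

theorem deformedRoot_mul_cancel (z : Rˣ) (i : ZMod 3) {f g : MvPolynomial (ZMod 3) R}
    (h : deformedRoot z i * f = deformedRoot z i * g) : f = g := by
  let φ : MvPolynomial (ZMod 3) R →ₐ[R] MvPolynomial (ZMod 3) R :=
    aeval fun j => if j = i then X i + C (z : R) * X (i + 1) else X j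
  let ψ : MvPolynomial (ZMod 3) R →ₐ[R] MvPolynomial (ZMod 3) R :=
    aeval fun j => if j = i then X i - C (z : R) * X (i + 1) else X j
  have hi : i + 1 ≠ i := by
    clear h
    revert i
    decide
  have hψφ : ψ.comp φ = AlgHom.id R _ := by
    ext j
    by_cases hj : j = i
    · subst hj
      simp [φ, ψ, hi]
    · simp [φ, ψ, hj]
  have hinj : Function.Injective φ := by
    intro u v huv
    have := congrArg ψ huv
    simpa [← AlgHom.comp_apply, hψφ] using this
  apply hinj
  have hr : φ (deformedRoot z i) = X i := by
    simp [φ, deformedRoot, hi]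
  have := congrArg φ h
  rw [map_mul, map_mul, hr] at this
  exact (MvPolynomial.isRegular_X (R := R) (n := i)).left this

/-- The composite `∂_{i₁} ∘ ⋯ ∘ ∂_{i_d}` along an expression `(i₁, …, i_d)`. -/
noncomputable def demazureWord (z : Rˣ) (w : List (ZMod 3)) (f : MvPolynomial (ZMod 3) R) :
    MvPolynomial (ZMod 3) R :=
  w.foldr (demazure z) f

/-- The expression `w(a, b, i) = (j - a, …, j - 2, j - 1, j, j - 1, …, i + 1, i)`, where
`j = i + b`, of length `a + b + 1`. -/
def wordABI (a b : ℕ) (i : ZMod 3) : List (ZMod 3) :=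
  (List.range a).map (fun t => i + b - a + t) ++ (List.range (b + 1)).map (fun t => i + b - t)

/-- The scalar `Ξ(a, b, i, k) = ∂_{w(a,b,i)} (x₁ ^ k x₂ ^ (ℓ - k))`, where `ℓ = a + b + 1`
(used for `0 ≤ k ≤ ℓ`); by `C_Xi` below, the polynomial on the right is a constant. -/
noncomputable def Xi (z : Rˣ) (a b : ℕ) (i : ZMod 3) (k : ℕ) : R :=
  constantCoeff (demazureWord z (wordABI a b i) (X 1 ^ k * X 2 ^ (a + b + 1 - k)))

theorem deformedReflection_isHomogeneous (z : Rˣ) (i : ZMod 3) {f : MvPolynomial (ZMod 3) R}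
    {n : ℕ} (hf : f.IsHomogeneous n) : (deformedReflection z i f).IsHomogeneous n := by
  have := IsHomogeneous.aeval (n := 1) hf (fun j =>
    if j = i then C (z : R) * X (i + 1)
    else if j = i + 1 then C ((z⁻¹ : Rˣ) : R) * X i
    else (X j : MvPolynomial (ZMod 3) R)) (by
      intro j
      split_ifs
      · simpa using (isHomogeneous_C _ _).mul (isHomogeneous_X R (i + 1))
      · simpa using (isHomogeneous_C _ _).mul (isHomogeneous_X R i)
      · exact isHomogeneous_X R j)
  simpa [deformedReflection] using this

theorem demazure_isHomogeneous (z : Rˣ) (i : ZMod 3) {f : MvPolynomial (ZMod 3) R}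
    {n : ℕ} (hf : f.IsHomogeneous (n + 1)) : (demazure z i f).IsHomogeneous n := by
  have hroot : (deformedRoot z i).IsHomogeneous 1 := by
    refine (isHomogeneous_X R i).sub ?_
    simpa using (isHomogeneous_C _ (z : R)).mul (isHomogeneous_X R (i + 1))
  have h := deformedRoot_mul_demazure z i f
  have hh : (deformedRoot z i * demazure z i f).IsHomogeneous (n + 1) :=
    h ▸ hf.sub (deformedReflection_isHomogeneous z i hf)
  have key : deformedRoot z i * demazure z i f =
      deformedRoot z i * homogeneousComponent n (demazure z i f) := by
    have h1 := congrArg (homogeneousComponent (n + 1))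
      (congrArg (deformedRoot z i * ·) (sum_homogeneousComponent (demazure z i f)))
    simp only [Finset.mul_sum, map_sum] at h1
    rw [homogeneousComponent_eq_self hh] at h1
    rw [← h1]
    have h2 : ∀ m, homogeneousComponent (n + 1)
        (deformedRoot z i * homogeneousComponent m (demazure z i f)) =
        if m = n then deformedRoot z i * homogeneousComponent n (demazure z i f) else 0 := by
      intro m
      have hm := hroot.mul (homogeneousComponent_isHomogeneous m (demazure z i f))
      rw [homogeneousComponent_of_mem hm]
      by_cases hmn : m = n
      · subst hmn
        simp [add_comm]
      · rw [if_neg (by omega), if_neg hmn]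
    simp only [h2, Finset.sum_ite_eq', Finset.mem_range]
    split_ifs with h3
    · rfl
    · rw [homogeneousComponent_eq_zero n _ (by omega), mul_zero]
  rw [deformedRoot_mul_cancel z i key]
  exact homogeneousComponent_isHomogeneous n _

theorem demazureWord_isHomogeneous (z : Rˣ) (w : List (ZMod 3)) {f : MvPolynomial (ZMod 3) R}
    {n : ℕ} (hf : f.IsHomogeneous (n + w.length)) : (demazureWord z w f).IsHomogeneous n := by
  induction w generalizing n with
  | nil => simpa [demazureWord] using hf
  | cons i w ih =>
    exact demazure_isHomogeneous z i (ih (n := n + 1) (by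
      rwa [List.length_cons, show n + (w.length + 1) = n + 1 + w.length by ring] at hf))

/-- `∂_{w(a,b,i)} (x₁ ^ k x₂ ^ (ℓ - k))` is the constant polynomial `Ξ(a, b, i, k)`. -/
theorem C_Xi (z : Rˣ) (a b : ℕ) (i : ZMod 3) (k : ℕ) (hk : k ≤ a + b + 1) :
    C (Xi z a b i k) = demazureWord z (wordABI a b i) (X 1 ^ k * X 2 ^ (a + b + 1 - k)) := by
  have hl : (wordABI a b i).length = a + b + 1 := by simp [wordABI, add_assoc]
  have h0 : (X 1 ^ k * X 2 ^ (a + b + 1 - k) : MvPolynomial (ZMod 3) R).IsHomogeneous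
      (0 + (wordABI a b i).length) := by
    have := (isHomogeneous_X_pow (R := R) (1 : ZMod 3) k).mul
      (isHomogeneous_X_pow (R := R) (2 : ZMod 3) (a + b + 1 - k))
    rwa [show k + (a + b + 1 - k) = 0 + (wordABI a b i).length by omega] at this
  have h1 := demazureWord_isHomogeneous z (wordABI a b i) h0
  have h2 := totalDegree_eq_zero_iff_eq_C.1 (Nat.le_zero.1 h1.totalDegree_le)
  rw [Xi, constantCoeff_eq]
  exact h2.symm

end Demazure

/-! ### The factors of the closed formula

Everything is a function of an invertible element `p`, with `z = p ^ 2` and `q = p ^ (-3)`. -/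

section Factors

variable {R : Type*} [CommRing R]

/-- `z = p ^ 2`. -/
def zOf (p : Rˣ) : Rˣ := p ^ (2 : ℤ)

/-- `q = p ^ (-3)`. -/
def qOf (p : Rˣ) : Rˣ := p ^ (-3 : ℤ)

/-- `q - q⁻¹`. -/
def qDiff (p : Rˣ) : R := (qOf p : R) - (((qOf p)⁻¹ : Rˣ) : R)

/-- `q ^ n` as a scalar. -/
def qPow (p : Rˣ) (n : ℤ) : R := ((qOf p ^ n : Rˣ) : R)

/-- `z ^ n` as a scalar. -/
def zPow (p : Rˣ) (n : ℤ) : R := ((zOf p ^ n : Rˣ) : R)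

/-- `p ^ n` as a scalar. -/
def pPow (p : Rˣ) (n : ℤ) : R := ((p ^ n : Rˣ) : R)

/-- The quantum integer `[n]` at `q = p ^ (-3)`. -/
def qInt (p : Rˣ) (n : ℤ) : R := quantumInt (qOf p) n

/-- `ρ'(d) = ∏_{c = 1}^d (1 - q ^ (-2 c))`. -/
def rhoPrime (p : Rˣ) (d : ℕ) : R :=
  ∏ c ∈ Finset.Icc 1 d, (1 - qPow p (-2 * (c : ℤ)))

/-- The function `magic(ν, k, β, ε)`: the sum over `0 ≤ j ≤ β` of
`q ^ (j (2 k - 3 ν - 2 ε)) [k - 1 choose β - j] [ν - 1 - k choose j]`. -/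
def magic (p : Rˣ) (ν k : ℤ) (β : ℕ) (ε : ℤ) : R :=
  ∑ j ∈ Finset.range (β + 1),
    qPow p (j * (2 * k - 3 * ν - 2 * ε)) *
      quantumChoose (qOf p) (k - 1) (β - j) * quantumChoose (qOf p) (ν - 1 - k) j

/-- For `n > 0`, the number `m` with `n = 2 m + 1` or `n = 2 m + 2`. It gives `α` from `a` and
`β` from `b`. -/
def halfPart (n : ℕ) : ℕ := (n - 1) / 2

theorem halfPart_spec (n : ℕ) (hn : 0 < n) :
    n = 2 * halfPart n + 1 ∨ n = 2 * halfPart n + 2 := by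
  unfold halfPart
  omega

/-- `ν = α + β + 2`. -/
def nuOf (a b : ℕ) : ℤ := halfPart a + halfPart b + 2

/-- `ℓ = a + b + 1`. -/
def lengthOf (a b : ℕ) : ℤ := a + b + 1

/-- `φ`, the number of even entries of the pair `(a, b)`. -/
def phiOf (a b : ℕ) : ℤ := (if Even a then 1 else 0) + (if Even b then 1 else 0)

/-- `μ = (-1) ^ (β + k)`. -/
def mu (b k : ℕ) : R := (-1) ^ (halfPart b + k)

/-- `γ₁ = ρ'(α) ρ'(β)`. -/
def gamma1 (p : Rˣ) (a b : ℕ) : R := rhoPrime p (halfPart a) * rhoPrime p (halfPart b)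

/-- `γ₂`. In the branches by `i`, the last one is `i = 3`. -/
def gamma2 (p : Rˣ) (a b : ℕ) (i : ZMod 3) (k : ℕ) : R :=
  let ν := nuOf a b
  let l := lengthOf a b
  if Odd a ∧ Odd b then 1
  else if Even a ∧ Odd b then qPow p (-ν) * qDiff p * qInt p (k - ν)
  else if Odd a ∧ Even b then
    if i = 1 then qPow p (-ν) * qDiff p * qInt p (ν - k)
    else if i = 2 then qPow p (-(l - 1)) * qDiff p * qInt p (l - 1 - k)
    else qPow p (-(l - 1)) * qDiff p * qInt p (1 - k)
  else
    if i = 1 then qPow p (-l) * qDiff p ^ 2 * qInt p (k - ν) * qInt p (ν + 1 - k)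
    else if i = 2 then
      qPow p (-(l + ν - 1)) * qDiff p ^ 2 * qInt p (k - ν) * qInt p (l - 1 - k)
    else qPow p (-(l + ν - 1)) * qDiff p ^ 2 * qInt p (k - 1) * qInt p (ν + 1 - k)

/-- `γ₃`. In the branches by `i`, the last one is `i = 3`. -/
def gamma3 (p : Rˣ) (a b : ℕ) (i : ZMod 3) (k : ℕ) : R :=
  let ν := nuOf a b
  let β := halfPart b
  if Odd a ∧ Odd b then magic p ν k β (-1)
  else if Even a ∧ Odd b then magic p ν k β 0
  else if Odd a ∧ Even b then
    if i = 1 then magic p ν k β 0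
    else if i = 2 then magic p ν k β (-1)
    else qPow p β * magic p ν (k - 1) β (-1)
  else
    if i = 1 then magic p ν k β 1
    else if i = 2 then magic p ν k β 0
    else qPow p β * magic p ν (k - 1) β 0

/-- `κ₁ = z ^ k q ^ (k (k - β - ℓ))`. -/
def kappa1 (p : Rˣ) (a b k : ℕ) : R :=
  zPow p k * qPow p (k * (k - halfPart b - lengthOf a b))

/-- `κ₂`. -/
def kappa2 (p : Rˣ) (i : ZMod 3) (k : ℕ) : R := if i = 2 then qPow p (2 * k) else 1

/-- `λ₁ = z ^ (β choose 2) z ^ (-(ℓ + 1 choose 2)) p ^ (-(β + 1) (ℓ + 3 β))`. -/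
def lambda1 (p : Rˣ) (a b : ℕ) : R :=
  zPow p ((halfPart b).choose 2 : ℕ) * zPow p (-((a + b + 2).choose 2 : ℕ)) *
    pPow p (-((halfPart b + 1) * (lengthOf a b + 3 * halfPart b)))

/-- `λ₂`. -/
def lambda2 (p : Rˣ) (a b : ℕ) : R :=
  if Odd a then zPow p (halfPart b) else zPow p (-(halfPart b : ℤ) - 3)

/-- `λ₃`. -/
def lambda3 (p : Rˣ) (a b : ℕ) : R := if Odd b then zPow p (lengthOf a b + 1) else 1

/-- `λ₄ = p ^ ((β + 3) (φ - 1))`. -/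
def lambda4 (p : Rˣ) (a b : ℕ) : R := pPow p ((halfPart b + 3) * (phiOf a b - 1))

/-- `λ₅`. In the branches by `i`, the last one is `i = 3`. -/
def lambda5 (p : Rˣ) (a b : ℕ) (i : ZMod 3) : R :=
  if i = 1 then 1
  else if i = 2 then zPow p (lengthOf a b)
  else zPow p (-lengthOf a b)

end Factors

/-! ### Constant terms of composites of Demazure operators. -/

section DemazureFunctional

open MvPolynomial

variable {R : Type*} [CommRing R]

/-! The word of (a, b + 1, i) is the word of (a, b, i + 1) followed by i, so one operator applied to
a monomial expresses the new scalars by the old ones. The mechanism is ∂_i(α_i f) = f + s_i f, with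
α_i the simple root. For i = 2, 3 and f divisible by x₁x₂, one of the two terms of α_i f is a
multiple of x₁x₂x₃; this product is fixed by every s_i, so it passes through the word and has no
constant term. Hence each new value is, up to a unit, a sum of two old ones, after a rotation of the
indices. For i = 1 only a first-order difference equation in k results, and the s₁-invariance of
(x₁x₂)^m supplies one value in the middle that fixes its solution. This is `XiRecursion`.

It remains to see that the closed formula obeys the same recursion (`XiStep`). By the q-binomial
theorem the series of [N choose j] t^j is, for N ≥ 0, a product of linear factors whose coefficients
form a geometric progression, so `magic` is a coefficient of a product of two such series.
Regrouping the progressions gives the symmetry `magic_reflect`; moving single linear factors gives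
the contiguous relations `magic_contiguous_left`, `magic_contiguous_right` and
`magic_contiguous_shift`. The steps from b odd to b even and back reduce to these.

The induction runs over b for fixed a, starting from b = 0, which is treated by induction on a.
Since the closed formula omits k = 0 and k = ℓ, one boundary value is carried along in
`HasXiValues`. -/

theorem demazure_eq_iff (z : Rˣ) (i : ZMod 3) (f g : MvPolynomial (ZMod 3) R) :
    demazure z i f = g ↔ deformedRoot z i * g = f - deformedReflection z i f := by
  constructor
  · rintro rfl
    exact deformedRoot_mul_demazure z i f
  · intro h
    exact deformedRoot_mul_cancel z i ((deformedRoot_mul_demazure z i f).trans h.symm)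

theorem demazure_add (z : Rˣ) (i : ZMod 3) (f g : MvPolynomial (ZMod 3) R) :
    demazure z i (f + g) = demazure z i f + demazure z i g := by
  rw [demazure_eq_iff, mul_add, deformedRoot_mul_demazure, deformedRoot_mul_demazure, map_add]
  ring

theorem demazure_mul_of_fixed (z : Rˣ) (i : ZMod 3) {e : MvPolynomial (ZMod 3) R}
    (he : deformedReflection z i e = e) (f : MvPolynomial (ZMod 3) R) :
    demazure z i (e * f) = e * demazure z i f := by
  rw [demazure_eq_iff, mul_left_comm, deformedRoot_mul_demazure, map_mul, he]
  ring

theorem demazure_C_mul (z : Rˣ) (i : ZMod 3) (c : R) (f : MvPolynomial (ZMod 3) R) :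
    demazure z i (C c * f) = C c * demazure z i f :=
  demazure_mul_of_fixed z i (by simp [deformedReflection]) f

theorem demazure_of_fixed (z : Rˣ) (i : ZMod 3) {e : MvPolynomial (ZMod 3) R}
    (he : deformedReflection z i e = e) : demazure z i e = 0 := by
  rw [demazure_eq_iff, he]
  ring

theorem deformedReflection_C (z : Rˣ) (i : ZMod 3) (c : R) :
    deformedReflection z i (C c) = C c := by
  simp [deformedReflection]

theorem deformedReflection_X_self (z : Rˣ) (i : ZMod 3) :
    deformedReflection z i (X i : MvPolynomial (ZMod 3) R) = C (z : R) * X (i + 1) := by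
  simp [deformedReflection]

theorem deformedReflection_X_succ (z : Rˣ) (i : ZMod 3) :
    deformedReflection z i (X (i + 1) : MvPolynomial (ZMod 3) R) =
      C ((z⁻¹ : Rˣ) : R) * X i := by
  simp [deformedReflection]

theorem deformedReflection_X_add_two (z : Rˣ) (i : ZMod 3) :
    deformedReflection z i (X (i + 2) : MvPolynomial (ZMod 3) R) = X (i + 2) := by
  have h1 : i + 2 ≠ i := by revert i; decide
  have h2 : i + 2 ≠ i + 1 := by revert i; decide
  simp [deformedReflection, h1, h2]

theorem C_unit_mul_C_inv (z : Rˣ) :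
    (C (z : R) : MvPolynomial (ZMod 3) R) * C ((z⁻¹ : Rˣ) : R) = 1 := by
  rw [← C_mul]
  simp

theorem deformedReflection_root (z : Rˣ) (i : ZMod 3) :
    deformedReflection z i (deformedRoot z i) = -deformedRoot z i := by
  rw [deformedRoot, map_sub, map_mul, deformedReflection_X_self, deformedReflection_X_succ,
    deformedReflection_C]
  linear_combination (-X i) * C_unit_mul_C_inv z

/-- `∂_i (α_i f) = f + s_i f`. -/
theorem demazure_root_mul (z : Rˣ) (i : ZMod 3) (f : MvPolynomial (ZMod 3) R) :
    demazure z i (deformedRoot z i * f) = f + deformedReflection z i f := by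
  rw [demazure_eq_iff, map_mul, deformedReflection_root]
  ring

theorem deformedReflection_prod_X (z : Rˣ) (i : ZMod 3) :
    deformedReflection z i (X i * X (i + 1) * X (i + 2) : MvPolynomial (ZMod 3) R) =
      X i * X (i + 1) * X (i + 2) := by
  rw [map_mul, map_mul, deformedReflection_X_self, deformedReflection_X_succ,
    deformedReflection_X_add_two]
  linear_combination (X i * X (i + 1) * X (i + 2)) * C_unit_mul_C_inv z

theorem prod_X_rotate (i : ZMod 3) :
    (X i * X (i + 1) * X (i + 2) : MvPolynomial (ZMod 3) R) = X 0 * X 1 * X 2 := by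
  have : ∀ i : ZMod 3, i = 0 ∨ i = 1 ∨ i = 2 := by decide
  rcases this i with rfl | rfl | rfl
  · simp
  · rw [show (1 : ZMod 3) + 1 = 2 by decide, show (1 : ZMod 3) + 2 = 0 by decide]
    ring
  · rw [show (2 : ZMod 3) + 1 = 0 by decide, show (2 : ZMod 3) + 2 = 1 by decide]
    ring

/-- The constant term of a composite of Demazure operators. -/
noncomputable def demazureValue (z : Rˣ) (w : List (ZMod 3)) (f : MvPolynomial (ZMod 3) R) : R :=
  constantCoeff (demazureWord z w f)

theorem demazureWord_add (z : Rˣ) (w : List (ZMod 3)) (f g : MvPolynomial (ZMod 3) R) :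
    demazureWord z w (f + g) = demazureWord z w f + demazureWord z w g := by
  induction w with
  | nil => rfl
  | cons i w ih =>
    have h := demazure_add z i (demazureWord z w f) (demazureWord z w g)
    rwa [← ih] at h

theorem demazureWord_C_mul (z : Rˣ) (w : List (ZMod 3)) (c : R) (f : MvPolynomial (ZMod 3) R) :
    demazureWord z w (C c * f) = C c * demazureWord z w f := by
  induction w with
  | nil => rfl
  | cons i w ih =>
    have h := demazure_C_mul z i c (demazureWord z w f)
    rwa [← ih] at h

theorem demazureWord_prod_X_mul (z : Rˣ) (w : List (ZMod 3)) (f : MvPolynomial (ZMod 3) R) :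
    demazureWord z w (X 0 * X 1 * X 2 * f) = X 0 * X 1 * X 2 * demazureWord z w f := by
  induction w with
  | nil => rfl
  | cons i w ih =>
    have h := demazure_mul_of_fixed z i (deformedReflection_prod_X z i) (demazureWord z w f)
    rw [prod_X_rotate] at h
    rwa [← ih] at h

theorem demazureValue_add (z : Rˣ) (w : List (ZMod 3)) (f g : MvPolynomial (ZMod 3) R) :
    demazureValue z w (f + g) = demazureValue z w f + demazureValue z w g := by
  simp [demazureValue, demazureWord_add]

theorem demazureValue_C_mul (z : Rˣ) (w : List (ZMod 3)) (c : R) (f : MvPolynomial (ZMod 3) R) :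
    demazureValue z w (C c * f) = c * demazureValue z w f := by
  simp [demazureValue, demazureWord_C_mul]

/-- The product of the variables commutes with every operator. This removes the unwanted term in the
recursions for the letters 2 and 0. -/
theorem demazureValue_prod_X_mul (z : Rˣ) (w : List (ZMod 3)) (f : MvPolynomial (ZMod 3) R) :
    demazureValue z w (X 0 * X 1 * X 2 * f) = 0 := by
  simp [demazureValue, demazureWord_prod_X_mul]

theorem demazureValue_append (z : Rˣ) (w : List (ZMod 3)) (i : ZMod 3)
    (f : MvPolynomial (ZMod 3) R) :
    demazureValue z (w ++ [i]) f = demazureValue z w (demazure z i f) := by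
  simp [demazureValue, demazureWord]

/-- Cyclic symmetry; it later turns monomials in x₁, x₀ or x₂, x₀ back into monomials in x₁, x₂. -/
theorem deformedReflection_rename (z : Rˣ) (i c : ZMod 3) (f : MvPolynomial (ZMod 3) R) :
    deformedReflection z (i + c) (rename (· + c) f) =
      rename (· + c) (deformedReflection z i f) := by
  have : (deformedReflection z (i + c)).comp (rename (R := R) (· + c)) =
      (rename (R := R) (· + c)).comp (deformedReflection z i) := by
    ext1 j
    simp only [AlgHom.comp_apply, rename_X, deformedReflection, aeval_X, add_right_cancel_iff,
      add_right_comm i c 1]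
    split_ifs <;> simp
  exact congrArg (fun φ => φ f) this

theorem deformedRoot_rename (z : Rˣ) (i c : ZMod 3) :
    deformedRoot z (i + c) = rename (· + c) (deformedRoot z i) := by
  simp [deformedRoot, add_right_comm i c 1]

theorem demazure_rename (z : Rˣ) (i c : ZMod 3) (f : MvPolynomial (ZMod 3) R) :
    demazure z (i + c) (rename (· + c) f) = rename (· + c) (demazure z i f) := by
  rw [demazure_eq_iff, deformedRoot_rename, ← map_mul, deformedRoot_mul_demazure, map_sub,
    deformedReflection_rename]

theorem demazureWord_rename (z : Rˣ) (w : List (ZMod 3)) (c : ZMod 3)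
    (f : MvPolynomial (ZMod 3) R) :
    demazureWord z (w.map (· + c)) (rename (· + c) f) = rename (· + c) (demazureWord z w f) := by
  induction w with
  | nil => rfl
  | cons i w ih =>
    have h := demazure_rename z i c (demazureWord z w f)
    rwa [← ih] at h

theorem demazureValue_rename (z : Rˣ) (w : List (ZMod 3)) (c : ZMod 3)
    (f : MvPolynomial (ZMod 3) R) :
    demazureValue z (w.map (· + c)) (rename (· + c) f) = demazureValue z w f := by
  simp [demazureValue, demazureWord_rename]

/-- Both terms of (x₁ - z x₂) x₁ ^ k x₂ ^ m are monomials in x₁, x₂ and neither drops out, so only a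
difference is determined. -/
theorem demazureValue_append_one (z : Rˣ) (w : List (ZMod 3)) (k m : ℕ) :
    demazureValue z (w ++ [1]) (X 1 ^ (k + 1) * X 2 ^ m) -
        (z : R) * demazureValue z (w ++ [1]) (X 1 ^ k * X 2 ^ (m + 1)) =
      demazureValue z w (X 1 ^ k * X 2 ^ m) +
        ((z ^ ((k : ℤ) - m) : Rˣ) : R) * demazureValue z w (X 1 ^ m * X 2 ^ k) := by
  have hs : deformedReflection z 1 (X 1 ^ k * X 2 ^ m : MvPolynomial (ZMod 3) R) =
      C ((z ^ ((k : ℤ) - m) : Rˣ) : R) * (X 1 ^ m * X 2 ^ k) := by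
    have h1 := deformedReflection_X_self (R := R) z 1
    have h2 := deformedReflection_X_succ (R := R) z 1
    rw [show (1 : ZMod 3) + 1 = 2 by decide] at h1 h2
    rw [map_mul, map_pow, map_pow, h1, h2, mul_pow, mul_pow, ← C_pow, ← C_pow,
      sub_eq_add_neg, zpow_add, zpow_neg, zpow_natCast, zpow_natCast, Units.val_mul, C_mul,
      ← inv_pow, Units.val_pow_eq_pow_val, Units.val_pow_eq_pow_val]
    ring
  have hr : demazure z 1 (X 1 ^ (k + 1) * X 2 ^ m + C (-(z : R)) * (X 1 ^ k * X 2 ^ (m + 1)) :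
      MvPolynomial (ZMod 3) R) =
      X 1 ^ k * X 2 ^ m + C ((z ^ ((k : ℤ) - m) : Rˣ) : R) * (X 1 ^ m * X 2 ^ k) := by
    rw [← hs, ← demazure_root_mul, deformedRoot, show (1 : ZMod 3) + 1 = 2 by decide]
    congr 1
    rw [C_neg]
    ring
  have := congrArg (demazureValue z w) hr
  rw [← demazureValue_append, demazureValue_add, demazureValue_add, demazureValue_C_mul,
    demazureValue_C_mul] at this
  linear_combination this

theorem demazure_append_two_aux (z : Rˣ) (w : List (ZMod 3)) (k m : ℕ) :
    demazureValue z (w ++ [2]) (X 1 ^ k * X 2 ^ (m + 1)) -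
        (z : R) * demazureValue z (w ++ [2]) (X 1 ^ k * X 2 ^ m * X 0) =
      demazureValue z w (X 1 ^ k * X 2 ^ m) +
        ((z ^ m : Rˣ) : R) * demazureValue z w (X 1 ^ k * X 0 ^ m) := by
  have hs : deformedReflection z 2 (X 1 ^ k * X 2 ^ m : MvPolynomial (ZMod 3) R) =
      C ((z ^ m : Rˣ) : R) * (X 1 ^ k * X 0 ^ m) := by
    have h1 := deformedReflection_X_self (R := R) z 2
    have h2 := deformedReflection_X_add_two (R := R) z 2
    rw [show (2 : ZMod 3) + 1 = 0 by decide] at h1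
    rw [show (2 : ZMod 3) + 2 = 1 by decide] at h2
    rw [map_mul, map_pow, map_pow, h1, h2, mul_pow, ← C_pow, Units.val_pow_eq_pow_val]
    ring
  have hr : demazure z 2 (X 1 ^ k * X 2 ^ (m + 1) + C (-(z : R)) * (X 1 ^ k * X 2 ^ m * X 0) :
      MvPolynomial (ZMod 3) R) =
      X 1 ^ k * X 2 ^ m + C ((z ^ m : Rˣ) : R) * (X 1 ^ k * X 0 ^ m) := by
    rw [← hs, ← demazure_root_mul, deformedRoot, show (2 : ZMod 3) + 1 = 0 by decide]
    congr 1
    rw [C_neg]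
    ring
  have := congrArg (demazureValue z w) hr
  rw [← demazureValue_append, demazureValue_add, demazureValue_add, demazureValue_C_mul,
    demazureValue_C_mul] at this
  linear_combination this

theorem demazureValue_append_two (z : Rˣ) (w : List (ZMod 3)) (k m : ℕ) (hk : 0 < k)
    (hm : 0 < m) :
    demazureValue z (w ++ [2]) (X 1 ^ k * X 2 ^ (m + 1)) =
      demazureValue z w (X 1 ^ k * X 2 ^ m) +
        ((z ^ m : Rˣ) : R) * demazureValue z w (X 1 ^ k * X 0 ^ m) := by
  have h := demazure_append_two_aux (R := R) z w k m
  obtain ⟨k, rfl⟩ := Nat.exists_eq_succ_of_ne_zero hk.ne'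
  obtain ⟨m, rfl⟩ := Nat.exists_eq_succ_of_ne_zero hm.ne'
  rw [show (X 1 ^ (k + 1) * X 2 ^ (m + 1) * X 0 : MvPolynomial (ZMod 3) R) =
    X 0 * X 1 * X 2 * (X 1 ^ k * X 2 ^ m) by ring, demazureValue_prod_X_mul, mul_zero,
    sub_zero] at h
  exact h

/-- The case m = 0, where x₁x₂x₃ does not divide the second term: here ∂₂ x₂ = 1 and x₁ is fixed by
s₂. -/
theorem demazureValue_append_two_last (z : Rˣ) (w : List (ZMod 3)) (k : ℕ) :
    demazureValue z (w ++ [2]) (X 1 ^ k * X 2) = demazureValue (R := R) z w (X 1 ^ k) := by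
  rw [demazureValue_append]
  congr 1
  have h2 := deformedReflection_X_add_two (R := R) z 2
  have h1 := deformedReflection_X_self (R := R) z 2
  rw [show (2 : ZMod 3) + 1 = 0 by decide] at h1
  rw [show (2 : ZMod 3) + 2 = 1 by decide] at h2
  rw [demazure_eq_iff, map_mul, map_pow, h1, h2, deformedRoot, show (2 : ZMod 3) + 1 = 0 by decide]
  ring

theorem demazureValue_append_two_zero (z : Rˣ) (w : List (ZMod 3)) (k : ℕ) :
    demazureValue (R := R) z (w ++ [2]) (X 1 ^ k) = 0 := by
  rw [demazureValue_append, demazure_of_fixed]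
  · have := demazureValue_C_mul (R := R) z w 0 0
    simpa using this
  · have h2 := deformedReflection_X_add_two (R := R) z 2
    rw [show (2 : ZMod 3) + 2 = 1 by decide] at h2
    rw [map_pow, h2]

theorem demazureValue_append_zero (z : Rˣ) (w : List (ZMod 3)) (k m : ℕ) (hk : 0 < k)
    (hm : 0 < m) :
    -(z : R) * demazureValue z (w ++ [0]) (X 1 ^ (k + 1) * X 2 ^ m) =
      demazureValue z w (X 1 ^ k * X 2 ^ m) +
        ((z ^ (-(k : ℤ)) : Rˣ) : R) * demazureValue z w (X 2 ^ m * X 0 ^ k) := by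
  have hs : deformedReflection z 0 (X 1 ^ k * X 2 ^ m : MvPolynomial (ZMod 3) R) =
      C ((z ^ (-(k : ℤ)) : Rˣ) : R) * (X 2 ^ m * X 0 ^ k) := by
    have h1 := deformedReflection_X_succ (R := R) z 0
    have h2 := deformedReflection_X_add_two (R := R) z 0
    rw [zero_add] at h1 h2
    rw [map_mul, map_pow, map_pow, h1, h2, mul_pow, ← C_pow, zpow_neg, zpow_natCast, ← inv_pow,
      Units.val_pow_eq_pow_val]
    ring
  have hr : demazure z 0 (X 1 ^ k * X 2 ^ m * X 0 + C (-(z : R)) * (X 1 ^ (k + 1) * X 2 ^ m) :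
      MvPolynomial (ZMod 3) R) =
      X 1 ^ k * X 2 ^ m + C ((z ^ (-(k : ℤ)) : Rˣ) : R) * (X 2 ^ m * X 0 ^ k) := by
    rw [← hs, ← demazure_root_mul, deformedRoot, zero_add]
    congr 1
    rw [C_neg]
    ring
  have h := congrArg (demazureValue z w) hr
  rw [← demazureValue_append, demazureValue_add, demazureValue_add, demazureValue_C_mul,
    demazureValue_C_mul] at h
  obtain ⟨k, rfl⟩ := Nat.exists_eq_succ_of_ne_zero hk.ne'
  obtain ⟨m, rfl⟩ := Nat.exists_eq_succ_of_ne_zero hm.ne'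
  rw [show (X 1 ^ (k + 1) * X 2 ^ (m + 1) * X 0 : MvPolynomial (ZMod 3) R) =
    X 0 * X 1 * X 2 * (X 1 ^ k * X 2 ^ m) by ring, demazureValue_prod_X_mul] at h
  linear_combination h

theorem demazureValue_append_zero_first (z : Rˣ) (w : List (ZMod 3)) (m : ℕ) :
    -(z : R) * demazureValue z (w ++ [0]) (X 1 * X 2 ^ m) =
      demazureValue (R := R) z w (X 2 ^ m) := by
  rw [demazureValue_append, ← demazureValue_C_mul, ← demazure_C_mul]
  congr 1
  have h1 := deformedReflection_X_succ (R := R) z 0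
  have h2 := deformedReflection_X_add_two (R := R) z 0
  rw [zero_add] at h1 h2
  rw [demazure_eq_iff, map_mul, map_mul, map_pow, h1, h2, deformedRoot, zero_add,
    deformedReflection_C, C_neg]
  linear_combination (-(X 0 * X 2 ^ m)) * C_unit_mul_C_inv z

/-- This invariance gives the anchors of the difference equation for the letter 1: ∂₁ kills (x₁x₂)^m
and sends (x₁x₂)^m x₁ to (x₁x₂)^m. -/
theorem deformedReflection_one_balanced (z : Rˣ) (m : ℕ) :
    deformedReflection z 1 (X 1 ^ m * X 2 ^ m : MvPolynomial (ZMod 3) R) = X 1 ^ m * X 2 ^ m := by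
  have h1 := deformedReflection_X_self (R := R) z 1
  have h2 := deformedReflection_X_succ (R := R) z 1
  rw [show (1 : ZMod 3) + 1 = 2 by decide] at h1 h2
  rw [← mul_pow, map_pow, map_mul, h1, h2]
  congr 1
  linear_combination (X 1 * X 2) * C_unit_mul_C_inv z

theorem demazureValue_append_one_balanced (z : Rˣ) (w : List (ZMod 3)) (m : ℕ) :
    demazureValue (R := R) z (w ++ [1]) (X 1 ^ m * X 2 ^ m) = 0 := by
  rw [demazureValue_append, demazure_of_fixed _ _ (deformedReflection_one_balanced z m)]
  simpa using demazureValue_C_mul (R := R) z w 0 0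

theorem demazureValue_append_one_centre (z : Rˣ) (w : List (ZMod 3)) (m : ℕ) :
    demazureValue (R := R) z (w ++ [1]) (X 1 ^ (m + 1) * X 2 ^ m) =
      demazureValue z w (X 1 ^ m * X 2 ^ m) := by
  rw [demazureValue_append, show (X 1 ^ (m + 1) * X 2 ^ m : MvPolynomial (ZMod 3) R) =
    X 1 ^ m * X 2 ^ m * X 1 by ring,
    demazure_mul_of_fixed _ _ (deformedReflection_one_balanced z m)]
  have : demazure z 1 (X 1 : MvPolynomial (ZMod 3) R) = 1 := by
    rw [demazure_eq_iff, deformedReflection_X_self, deformedRoot, mul_one]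
  rw [this, mul_one]

/-- The sum x₁ ^ l + z ^ l x₂ ^ l is x₁ ^ l plus its image under s₁, hence is killed by ∂₁. -/
theorem demazureValue_append_one_antisymm (z : Rˣ) (w : List (ZMod 3)) (l : ℕ) :
    demazureValue (R := R) z (w ++ [1]) (X 1 ^ l) =
      -(((z ^ l : Rˣ) : R) * demazureValue z (w ++ [1]) (X 2 ^ l)) := by
  rw [eq_neg_iff_add_eq_zero, ← demazureValue_C_mul, ← demazureValue_add, demazureValue_append,
    demazure_of_fixed]
  · simpa using demazureValue_C_mul (R := R) z w 0 0
  · have h1 := deformedReflection_X_self (R := R) z 1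
    have h2 := deformedReflection_X_succ (R := R) z 1
    rw [show (1 : ZMod 3) + 1 = 2 by decide] at h1 h2
    have h3 : (C (z : R) : MvPolynomial (ZMod 3) R) ^ l * C ((z⁻¹ : Rˣ) : R) ^ l = 1 := by
      rw [← mul_pow, C_unit_mul_C_inv, one_pow]
    rw [map_add, map_mul, map_pow, map_pow, h1, h2, deformedReflection_C,
      Units.val_pow_eq_pow_val, C_pow]
    linear_combination (X 1 ^ l) * h3

/-! ### The words w(a, b, i) and the recursion for their scalars. -/

theorem wordABI_eq_map (a b : ℕ) (i : ZMod 3) :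
    wordABI a b i = (List.range a).map (fun t : ℕ => i + b - a + t) ++
      (List.range (b + 1)).map (fun t : ℕ => i + b - t) := by
  simp only [wordABI, bind_pure_comp, List.map_eq_map, List.map_map]
  rfl

theorem wordABI_succ (a b : ℕ) (i : ZMod 3) :
    wordABI a (b + 1) i = wordABI a b (i + 1) ++ [i] := by
  rw [wordABI_eq_map, wordABI_eq_map, List.range_succ (n := b + 1), List.map_append,
    List.append_assoc]
  congr 1
  · refine List.map_congr_left fun t _ => ?_
    push_cast
    ring
  · congr 1
    · refine List.map_congr_left fun t _ => ?_
      push_cast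
      ring
    · simp

theorem wordABI_succ_zero (a : ℕ) (i : ZMod 3) :
    wordABI (a + 1) 0 i = wordABI a 0 (i - 1) ++ [i] := by
  rw [wordABI_eq_map, wordABI_eq_map, List.range_succ (n := a), List.map_append]
  congr 1
  · congr 1
    · refine List.map_congr_left fun t _ => ?_
      push_cast
      ring
    · simp
      ring
  · simp

theorem wordABI_shift (a b : ℕ) (i c : ZMod 3) :
    (wordABI a b i).map (· + c) = wordABI a b (i + c) := by
  rw [wordABI_eq_map, wordABI_eq_map, List.map_append, List.map_map, List.map_map]
  congr 1
  all_goals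
    refine List.map_congr_left fun t _ => ?_
    simp only [Function.comp_apply]
    ring

theorem Xi_eq_demazureValue (z : Rˣ) (a b : ℕ) (i : ZMod 3) {k m : ℕ} (h : k + m = a + b + 1) :
    Xi z a b i k = demazureValue (R := R) z (wordABI a b i) (X 1 ^ k * X 2 ^ m) := by
  rw [Xi, demazureValue, ← h, Nat.add_sub_cancel_left]

theorem demazureValue_one_zero (z : Rˣ) {w w' : List (ZMod 3)} (hw : w.map (· + 1) = w')
    (k m : ℕ) :
    demazureValue (R := R) z w (X 1 ^ k * X 0 ^ m) =
      demazureValue z w' (X 1 ^ m * X 2 ^ k) := by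
  rw [← demazureValue_rename z w 1, hw, map_mul, map_pow, map_pow, rename_X, rename_X, zero_add,
    show (1 : ZMod 3) + 1 = 2 by decide, mul_comm]

theorem demazureValue_two_zero (z : Rˣ) {w w' : List (ZMod 3)} (hw : w.map (· + 2) = w')
    (k m : ℕ) :
    demazureValue (R := R) z w (X 2 ^ k * X 0 ^ m) =
      demazureValue z w' (X 1 ^ k * X 2 ^ m) := by
  rw [← demazureValue_rename z w 2, hw, map_mul, map_pow, map_pow, rename_X, rename_X, zero_add,
    show (2 : ZMod 3) + 2 = 1 by decide]

/-- The relations between the values `Y` of words of length `L + 1` on the monomials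
`x₁ ^ k x₂ ^ (L + 1 - k)` and the values `X` of the words obtained by removing the last letter. -/
structure XiRecursion (z : Rˣ) (L : ℕ) (X Y : ZMod 3 → ℕ → R) : Prop where
  one : ∀ k m, k + m = L → Y 1 (k + 1) - (z : R) * Y 1 k =
    X 2 k + ((z ^ ((k : ℤ) - m) : Rˣ) : R) * X 2 m
  one_balanced : ∀ m, m + m = L + 1 → Y 1 m = 0
  one_centre : ∀ m, m + m = L → Y 1 (m + 1) = X 2 m
  two : ∀ k m, k + m = L → 0 < k → 0 < m → Y 2 k = X 0 k + ((z ^ m : Rˣ) : R) * X 1 m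
  two_last : Y 2 L = X 0 L
  zero : ∀ k m, k + m = L → 0 < k → 0 < m →
    -(z : R) * Y 0 (k + 1) = X 1 k + ((z ^ (-(k : ℤ)) : Rˣ) : R) * X 0 m
  zero_first : -(z : R) * Y 0 1 = X 0 L
  edge : Y 1 0 = Y 0 (L + 1)

/-- The offset c covers both ways of lengthening a word: c = 0 raises b, and c = 1 raises a when b =
0, because i + 2 = i - 1 modulo 3. -/
theorem xiRecursion_of_word (z : Rˣ) {a b a' b' : ℕ} (c : ZMod 3) (hl : a' + b' = a + b + 1)
    (hw : ∀ i, wordABI a' b' i = wordABI a b (i + 1 + c) ++ [i]) :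
    XiRecursion (R := R) z (a + b + 1) (fun i => Xi z a b (i + c)) (Xi z a' b') := by
  have h01 : wordABI a' b' 0 = wordABI a b (1 + c) ++ [0] := by rw [hw, zero_add]
  have h12 : wordABI a' b' 1 = wordABI a b (2 + c) ++ [1] := by
    rw [hw, show (1 : ZMod 3) + 1 = 2 by decide]
  have h20 : wordABI a' b' 2 = wordABI a b (0 + c) ++ [2] := by
    rw [hw, show (2 : ZMod 3) + 1 = 0 by decide]
  have s1 : (wordABI a b (0 + c)).map (· + 1) = wordABI a b (1 + c) := by
    rw [wordABI_shift, zero_add, add_comm]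
  have s2 : (wordABI a b (1 + c)).map (· + 2) = wordABI a b (0 + c) := by
    rw [wordABI_shift, add_right_comm, show (1 : ZMod 3) + 2 = 0 by decide]
  have s3 : (wordABI a' b' 1).map (· + 2) = wordABI a' b' 0 := by
    rw [wordABI_shift, show (1 : ZMod 3) + 2 = 0 by decide]
  constructor
  · intro k m h
    rw [Xi_eq_demazureValue z a b _ h, Xi_eq_demazureValue z a b _ (add_comm k m ▸ h),
      Xi_eq_demazureValue z a' b' 1 (k := k + 1) (m := m) (by omega),
      Xi_eq_demazureValue z a' b' 1 (k := k) (m := m + 1) (by omega), h12,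
      demazureValue_append_one]
  · intro m h
    rw [Xi_eq_demazureValue z a' b' 1 (m := m) (by omega), h12, demazureValue_append_one_balanced]
  · intro m h
    rw [Xi_eq_demazureValue z a b _ h, Xi_eq_demazureValue z a' b' 1 (m := m) (by omega), h12,
      demazureValue_append_one_centre]
  · intro k m h hk hm
    rw [Xi_eq_demazureValue z a b _ h, Xi_eq_demazureValue z a b _ (add_comm k m ▸ h),
      ← demazureValue_one_zero z s1, Xi_eq_demazureValue z a' b' 2 (m := m + 1) (by omega), h20,
      demazureValue_append_two _ _ _ _ hk hm]
  · rw [Xi_eq_demazureValue z a b _ (add_zero _),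
      Xi_eq_demazureValue z a' b' 2 (k := a + b + 1) (m := 1) (by omega), h20, pow_one,
      demazureValue_append_two_last, pow_zero, mul_one]
  · intro k m h hk hm
    rw [Xi_eq_demazureValue z a b _ h, Xi_eq_demazureValue z a b _ (add_comm k m ▸ h),
      ← demazureValue_two_zero z s2, Xi_eq_demazureValue z a' b' 0 (m := m) (by omega), h01,
      demazureValue_append_zero _ _ _ _ hk hm]
  · rw [Xi_eq_demazureValue z a b _ (add_zero _), ← demazureValue_two_zero z s2,
      Xi_eq_demazureValue z a' b' 0 (k := 1) (m := a + b + 1) (by omega), h01, pow_one,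
      demazureValue_append_zero_first, pow_zero, mul_one]
  · rw [Xi_eq_demazureValue z a' b' 1 (k := 0) (m := a + b + 1 + 1) (by omega),
      Xi_eq_demazureValue z a' b' 0 (k := a + b + 1 + 1) (m := 0) (by omega),
      ← demazureValue_two_zero z s3, pow_zero, pow_zero, one_mul, mul_one]

theorem xiRecursion_succ (z : Rˣ) (a b : ℕ) :
    XiRecursion (R := R) z (a + b + 1) (Xi z a b) (Xi z a (b + 1)) := by
  have h := xiRecursion_of_word (R := R) z (a := a) (b := b) (a' := a) (b' := b + 1) 0 (by omega)
    fun i => by rw [wordABI_succ, add_zero]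
  simpa only [add_zero] using h

theorem xiRecursion_succ_zero (z : Rˣ) (a : ℕ) :
    XiRecursion (R := R) z (a + 1) (fun i => Xi z a 0 (i + 1)) (Xi z (a + 1) 0) :=
  xiRecursion_of_word (a := a) (b := 0) (a' := a + 1) (b' := 0) z 1 rfl fun i => by
    rw [wordABI_succ_zero, add_assoc, show (1 : ZMod 3) + 1 = -1 by decide, sub_eq_add_neg]

theorem wordABI_last (a b : ℕ) (i : ZMod 3) : ∃ w, wordABI a b i = w ++ [i] := by
  rcases b with _ | b
  · rcases a with _ | a
    · exact ⟨[], by simp [wordABI]⟩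
    · exact ⟨_, wordABI_succ_zero a i⟩
  · exact ⟨_, wordABI_succ a b i⟩

/-- With the next two lemmas this reduces all six boundary values, at k = 0 and k = ℓ, to the single
unknown Ξ(a, b, 3, ℓ). Here x₁ is fixed by s₂, the operator applied first. -/
theorem Xi_two_length (z : Rˣ) (a b : ℕ) : (Xi z a b 2 (a + b + 1) : R) = 0 := by
  obtain ⟨w, hw⟩ := wordABI_last a b 2
  rw [Xi_eq_demazureValue z a b 2 (add_zero _), hw, pow_zero, mul_one,
    demazureValue_append_two_zero]

theorem Xi_zero_right (z : Rˣ) (a b : ℕ) (i : ZMod 3) :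
    (Xi z a b i 0 : R) = Xi z a b (i + 2) (a + b + 1) := by
  rw [Xi_eq_demazureValue z a b i (zero_add _), Xi_eq_demazureValue z a b _ (add_zero _),
    ← demazureValue_two_zero z (wordABI_shift a b i 2), pow_zero, pow_zero, one_mul, mul_one]

theorem Xi_one_length (z : Rˣ) (a b : ℕ) :
    (Xi z a b 1 (a + b + 1) : R) =
      -(((z ^ (a + b + 1) : Rˣ) : R) * Xi z a b 0 (a + b + 1)) := by
  obtain ⟨w, hw⟩ := wordABI_last a b 1
  rw [show (0 : ZMod 3) = 1 + 2 by decide, ← Xi_zero_right,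
    Xi_eq_demazureValue z a b 1 (add_zero _), Xi_eq_demazureValue z a b 1 (zero_add _), hw,
    pow_zero, mul_one, pow_zero, one_mul, demazureValue_append_one_antisymm]

end DemazureFunctional

/-! ### Pascal rules for quantum binomials with integer upper entry. -/

section QuantumChoose

variable {R : Type*} [CommRing R]

theorem quantumChooseNat_eq_zero (q : Rˣ) {n j : ℕ} (h : n < j) :
    quantumChooseNat q n j = 0 := by
  induction n generalizing j with
  | zero =>
    obtain ⟨j, rfl⟩ := Nat.exists_eq_succ_of_ne_zero h.ne'
    rfl
  | succ n ih =>
    obtain ⟨j, rfl⟩ := Nat.exists_eq_succ_of_ne_zero (Nat.ne_zero_of_lt h)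
    rw [Nat.succ_eq_add_one, quantumChooseNat, ih (by omega), ih (by omega), mul_zero, mul_zero,
      add_zero]

theorem quantumChooseNat_zero_right (q : Rˣ) (n : ℕ) : quantumChooseNat q n 0 = 1 := by
  cases n <;> rfl

theorem quantumChooseNat_self (q : Rˣ) (n : ℕ) : quantumChooseNat q n n = 1 := by
  induction n with
  | zero => rfl
  | succ n ih => simp [quantumChooseNat, ih, quantumChooseNat_eq_zero q (Nat.lt_succ_self n)]

/-- The absorption rule times q - q⁻¹; it is exactly the difference of the two Pascal rules. It is
proved by induction rather than from the product formula, since [j]! may be a zero divisor. -/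
theorem sub_mul_quantumChooseNat_succ (q : Rˣ) (n j : ℕ) :
    (((q ^ ((j : ℤ) + 1) : Rˣ) : R) - ((q ^ (-((j : ℤ) + 1)) : Rˣ) : R)) *
        quantumChooseNat q n (j + 1) =
      (((q ^ ((n : ℤ) - j) : Rˣ) : R) - ((q ^ ((j : ℤ) - n) : Rˣ) : R)) *
        quantumChooseNat q n j := by
  induction n generalizing j with
  | zero =>
    rcases j with _ | j
    · simp [quantumChooseNat]
    · simp [quantumChooseNat]
  | succ n ih =>
    rcases j with _ | j
    · have h := ih 0
      simp only [quantumChooseNat, quantumChooseNat_zero_right] at h ⊢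
      push_cast at h ⊢
      have e1 : (q : R) * ((q⁻¹ : Rˣ) : R) = 1 := by simp
      simp only [zpow_one, zpow_neg_one, zero_sub, sub_zero, neg_add, zpow_add,
        Units.val_mul] at h ⊢
      linear_combination (q : R) * h
    · have h1 := ih (j + 1)
      have h2 := ih j
      simp only [quantumChooseNat]
      push_cast at h1 h2 ⊢
      have e1 : (q : R) * ((q⁻¹ : Rˣ) : R) = 1 := by simp
      simp only [sub_eq_add_neg, neg_add, zpow_add, zpow_one, zpow_neg_one,
        Units.val_mul] at h1 h2 ⊢
      generalize ((q⁻¹ : Rˣ) : R) = q' at *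
      generalize (q : R) = Q at *
      generalize ((q ^ (j : ℤ) : Rˣ) : R) = J at *
      generalize ((q ^ (-(j : ℤ)) : Rˣ) : R) = J' at *
      generalize ((q ^ (n : ℤ) : Rˣ) : R) = N at *
      generalize ((q ^ (-(n : ℤ)) : Rˣ) : R) = N' at *
      generalize quantumChooseNat q n (j + 1 + 1) = c2 at *
      generalize quantumChooseNat q n (j + 1) = c1 at *
      generalize quantumChooseNat q n j = c0 at *
      linear_combination J * Q * Q * h1 + J * N' * h2 + c1 * J * J' * (Q * N - q' * N') * e1 -
        (N * J' - J * N') * (J * Q * c1 + J * N' * c0) * e1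

theorem quantumChooseNat_succ_succ' (q : Rˣ) (n j : ℕ) :
    quantumChooseNat q (n + 1) (j + 1) =
      ((q ^ (-((j : ℤ) + 1)) : Rˣ) : R) * quantumChooseNat q n (j + 1) +
        ((q ^ ((n : ℤ) - j) : Rˣ) : R) * quantumChooseNat q n j := by
  have h := sub_mul_quantumChooseNat_succ (R := R) q n j
  rw [quantumChooseNat]
  linear_combination h

theorem quantumChooseNat_succ_succ (q : Rˣ) (n j : ℕ) :
    quantumChooseNat q (n + 1) (j + 1) =
      ((q ^ ((j : ℤ) + 1) : Rˣ) : R) * quantumChooseNat q n (j + 1) +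
        ((q ^ ((j : ℤ) - (n : ℤ)) : Rˣ) : R) * quantumChooseNat q n j := rfl

theorem quantumChoose_natCast (q : Rˣ) (n j : ℕ) :
    quantumChoose q (n : ℤ) j = quantumChooseNat q n j := rfl

theorem quantumChoose_zero_right (q : Rˣ) (m : ℤ) : quantumChoose q m 0 = 1 := by
  cases m <;> simp [quantumChoose, quantumChooseNat_zero_right]

/-- The quantum Pascal rule, for an arbitrary integer upper entry. -/
theorem quantumChoose_succ_succ (q : Rˣ) (m : ℤ) (j : ℕ) :
    quantumChoose q (m + 1) (j + 1) =
      ((q ^ ((j : ℤ) + 1) : Rˣ) : R) * quantumChoose q m (j + 1) +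
        ((q ^ ((j : ℤ) - m) : Rˣ) : R) * quantumChoose q m j := by
  rcases m with n | n
  · rfl
  · rcases n with _ | n
    · have e : Int.negSucc 0 + 1 = ((0 : ℕ) : ℤ) := rfl
      rw [e, quantumChoose_natCast, quantumChooseNat_eq_zero q (Nat.succ_pos j)]
      simp only [quantumChoose, zero_add, quantumChooseNat_self, Int.negSucc_eq]
      push_cast
      rw [show (j : ℤ) - -1 = j + 1 by ring]
      ring
    · have e : Int.negSucc (n + 1) + 1 = Int.negSucc n := by
        simp only [Int.negSucc_eq]
        push_cast
        ring
      rw [e]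
      simp only [quantumChoose]
      -- Upper negation exchanges the two Pascal rules, so a negative entry needs the other rule.
      have h := quantumChooseNat_succ_succ' (R := R) q (n + j + 1) j
      rw [show n + 1 + (j + 1) = n + j + 1 + 1 by ring, show n + (j + 1) = n + j + 1 by ring,
        show n + 1 + j = n + j + 1 by ring, h, Int.negSucc_eq]
      push_cast
      rw [show (j : ℤ) - -((n : ℤ) + 1 + 1) = (j + 1) + (n + 1) by ring,
        show (n : ℤ) + j + 1 - j = n + 1 by ring, zpow_add q ((j : ℤ) + 1),
        Units.val_mul, zpow_neg]
      have h3 : ((q ^ ((j : ℤ) + 1) : Rˣ) : R) * (((q ^ ((j : ℤ) + 1))⁻¹ : Rˣ) : R) = 1 := by simp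
      linear_combination (-1) ^ j * quantumChooseNat q (n + j + 1) (j + 1) * h3

/-- The quantum Pascal rule with `q` inverted. -/
theorem quantumChoose_succ_succ' (q : Rˣ) (m : ℤ) (j : ℕ) :
    quantumChoose q (m + 1) (j + 1) =
      ((q ^ (-((j : ℤ) + 1)) : Rˣ) : R) * quantumChoose q m (j + 1) +
        ((q ^ (m - j) : Rˣ) : R) * quantumChoose q m j := by
  rcases m with n | n
  · exact quantumChooseNat_succ_succ' q n j
  · rcases n with _ | n
    · have e : Int.negSucc 0 + 1 = ((0 : ℕ) : ℤ) := rfl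
      rw [e, quantumChoose_natCast, quantumChooseNat_eq_zero q (Nat.succ_pos j)]
      simp only [quantumChoose, zero_add, quantumChooseNat_self, Int.negSucc_eq]
      push_cast
      rw [show (-1 : ℤ) - j = -(j + 1) by ring]
      ring
    · have e : Int.negSucc (n + 1) + 1 = Int.negSucc n := by
        simp only [Int.negSucc_eq]
        push_cast
        ring
      rw [e]
      simp only [quantumChoose]
      rw [show n + 1 + (j + 1) = n + j + 1 + 1 by ring, show n + (j + 1) = n + j + 1 by ring,
        show n + 1 + j = n + j + 1 by ring, quantumChooseNat_succ_succ q (n + j + 1),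
        Int.negSucc_eq]
      push_cast
      rw [show -((n : ℤ) + 1 + 1) - j = -(j + 1) + -(n + 1) by ring,
        show (j : ℤ) - (n + j + 1) = -(n + 1) by ring, zpow_add q (-((j : ℤ) + 1)),
        Units.val_mul, zpow_neg q (j + 1)]
      have h3 : ((q ^ ((j : ℤ) + 1) : Rˣ) : R) * (((q ^ ((j : ℤ) + 1))⁻¹ : Rˣ) : R) = 1 := by simp
      linear_combination (-1) ^ j * quantumChooseNat q (n + j + 1) (j + 1) * h3

theorem quantumChoose_zero_left_succ (q : Rˣ) (j : ℕ) : quantumChoose q 0 (j + 1) = 0 :=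
  quantumChooseNat_eq_zero q (Nat.succ_pos j)

end QuantumChoose

/-! ### Powers of p and the q-binomial theorem as an identity of power series. -/

section ChooseSeries

open PowerSeries

variable {R : Type*} [CommRing R]

theorem pPow_add (p : Rˣ) (m n : ℤ) : pPow p (m + n) = pPow p m * pPow p n := by
  simp [pPow, zpow_add]

theorem pPow_zero (p : Rˣ) : pPow p 0 = 1 := by
  simp [pPow]

theorem qOf_zpow (p : Rˣ) (n : ℤ) : ((qOf p ^ n : Rˣ) : R) = pPow p (-3 * n) := by
  rw [qOf, pPow, zpow_mul]

theorem zOf_zpow (p : Rˣ) (n : ℤ) : ((zOf p ^ n : Rˣ) : R) = pPow p (2 * n) := by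
  rw [zOf, pPow, zpow_mul]

theorem qPow_eq (p : Rˣ) (n : ℤ) : qPow p n = pPow p (-3 * n) := qOf_zpow p n

theorem zPow_eq (p : Rˣ) (n : ℤ) : zPow p n = pPow p (2 * n) := zOf_zpow p n

theorem qDiff_mul_qInt (p : Rˣ) (n : ℤ) :
    qDiff p * qInt p n = pPow p (-3 * n) - pPow p (3 * n) := by
  rw [qDiff, qInt, sub_inv_mul_quantumInt, qOf_zpow, qOf_zpow]
  congr 2
  ring

/-- The series `∑ p ^ (x j) [N choose j] t ^ j`, with quantum binomials at `q = p ^ (-3)`. -/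
noncomputable def chooseSeries (p : Rˣ) (N x : ℤ) : PowerSeries R :=
  PowerSeries.mk fun j => pPow p (x * j) * quantumChoose (qOf p) N j

/-- The linear series `1 + p ^ x t`. -/
noncomputable def linearSeries (p : Rˣ) (x : ℤ) : PowerSeries R := 1 + C (pPow p x) * X

/-- For N ≥ 0 the series is the product of the factors 1 + p ^ e t with e running from x - 3 (N - 1)
to x + 3 (N - 1) in steps of 6. This form of Pascal's rule splits off the largest exponent,
`chooseSeries_succ'` the smallest. -/
theorem chooseSeries_succ (p : Rˣ) (N x : ℤ) :
    chooseSeries p (N + 1) x = chooseSeries p N (x - 3) * linearSeries p (x + 3 * N) := by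
  ext j
  rw [linearSeries, mul_add, mul_one, mul_left_comm, map_add, coeff_C_mul]
  rcases j with _ | j
  · rw [coeff_zero_mul_X]
    simp [chooseSeries, quantumChoose_zero_right]
  · rw [coeff_succ_mul_X]
    simp only [chooseSeries, coeff_mk, quantumChoose_succ_succ, qOf_zpow]
    push_cast
    rw [mul_add, ← mul_assoc, ← mul_assoc, ← mul_assoc, ← pPow_add, ← pPow_add, ← pPow_add]
    ring_nf

theorem chooseSeries_succ' (p : Rˣ) (N x : ℤ) :
    chooseSeries p (N + 1) x = chooseSeries p N (x + 3) * linearSeries p (x - 3 * N) := by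
  ext j
  rw [linearSeries, mul_add, mul_one, mul_left_comm, map_add, coeff_C_mul]
  rcases j with _ | j
  · rw [coeff_zero_mul_X]
    simp [chooseSeries, quantumChoose_zero_right]
  · rw [coeff_succ_mul_X]
    simp only [chooseSeries, coeff_mk, quantumChoose_succ_succ', qOf_zpow]
    push_cast
    rw [mul_add, ← mul_assoc, ← mul_assoc, ← mul_assoc, ← pPow_add, ← pPow_add, ← pPow_add]
    ring_nf

theorem chooseSeries_zero (p : Rˣ) (x : ℤ) : chooseSeries p 0 x = 1 := by
  ext j
  rcases j with _ | j
  · simp [chooseSeries, quantumChoose_zero_right, pPow_zero]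
  · simp [chooseSeries, quantumChoose_zero_left_succ, coeff_one]

theorem linearSeries_isUnit (p : Rˣ) (x : ℤ) : IsUnit (linearSeries p x) := by
  rw [PowerSeries.isUnit_iff_constantCoeff]
  simp [linearSeries]

/-- For M, N ≥ 0 the progression of exponents is cut into its lower M and its upper N terms.
Negative N is reached by cancelling linear factors, which are units. -/
theorem chooseSeries_add (p : Rˣ) (M N x : ℤ) :
    chooseSeries p (M + N) x =
      chooseSeries p M (x - 3 * N) * chooseSeries p N (x + 3 * M) := by
  have step : ∀ N x : ℤ, chooseSeries p M (x - 3 * (N + 1)) * chooseSeries p (N + 1) (x + 3 * M) =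
      chooseSeries p M (x - 3 - 3 * N) * chooseSeries p N (x - 3 + 3 * M) *
        linearSeries p (x + 3 * (M + N)) := by
    intro N x
    rw [chooseSeries_succ, mul_assoc]
    ring_nf
  induction N using Int.induction_on generalizing x with
  | zero => simp [chooseSeries_zero]
  | succ n ih => rw [step, ← ih, ← add_assoc, chooseSeries_succ]
  | pred n ih =>
    have h1 := step (-(n : ℤ) - 1) (x + 3)
    rw [sub_add_cancel, ← ih, show M + -(n : ℤ) = M + (-n - 1) + 1 by ring, chooseSeries_succ,
      add_sub_cancel_right] at h1
    exact (linearSeries_isUnit p _).mul_right_cancel h1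

/-- The substitution t ↦ p ^ d t. -/
theorem coeff_chooseSeries_mul_shift (p : Rˣ) (M N x y d : ℤ) (n : ℕ) :
    coeff n (chooseSeries p M (x + d) * chooseSeries p N (y + d)) =
      pPow p (d * n) * coeff n (chooseSeries p M x * chooseSeries p N y) := by
  rw [coeff_mul, coeff_mul, Finset.mul_sum]
  refine Finset.sum_congr rfl fun ij hij => ?_
  replace hij := Finset.HasAntidiagonal.mem_antidiagonal.1 hij
  simp only [chooseSeries, coeff_mk, ← hij]
  push_cast
  rw [show (x + d) * (ij.1 : ℤ) = x * ij.1 + d * ij.1 by ring,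
    show (y + d) * (ij.2 : ℤ) = y * ij.2 + d * ij.2 by ring, mul_add d, pPow_add, pPow_add,
    pPow_add]
  ring

/-! ### Reflection and contiguous relations for `magic`. -/

theorem magic_eq_coeff (p : Rˣ) (ν k : ℤ) (β : ℕ) (ε : ℤ) :
    magic p ν k β ε = coeff β (chooseSeries p (k - 1) 0 *
      chooseSeries p (ν - 1 - k) (-3 * (2 * k - 3 * ν - 2 * ε))) := by
  rw [mul_comm, coeff_mul, Finset.Nat.sum_antidiagonal_eq_sum_range_succ_mk, magic]
  refine Finset.sum_congr rfl fun j _ => ?_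
  simp only [chooseSeries, coeff_mk, zero_mul, pPow_zero, qPow_eq]
  ring_nf

theorem magic_eq_shift (p : Rˣ) (ν k : ℤ) (β : ℕ) (ε d : ℤ) :
    pPow p (d * β) * magic p ν k β ε = coeff β (chooseSeries p (k - 1) d *
      chooseSeries p (ν - 1 - k) (-3 * (2 * k - 3 * ν - 2 * ε) + d)) := by
  have h := coeff_chooseSeries_mul_shift p (k - 1) (ν - 1 - k) 0
    (-3 * (2 * k - 3 * ν - 2 * ε)) d β
  rw [zero_add] at h
  rw [h, magic_eq_coeff]

/-- On each side the first series is cut so that a piece of length ν + ε splits off. After rescaling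
t, both sides are the product of the same three series, of lengths ν + ε, ν - 1 - k and ν - 1 - m.
-/
theorem magic_reflect (p : Rˣ) {ν m k ε : ℤ} (β : ℕ) (h : m + k = 2 * ν + ε) :
    magic p ν m β ε = pPow p (-3 * (2 * ν + ε - 2 * k) * β) * magic p ν k β ε := by
  obtain rfl : m = 2 * ν + ε - k := by linarith
  rw [magic_eq_shift, magic_eq_coeff]
  have h1 := chooseSeries_add p (ν + ε) (ν - 1 - k) 0
  have h2 := chooseSeries_add p (ν + ε) (ν - 1 - (2 * ν + ε - k)) (-3 * (2 * ν + ε - 2 * k))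
  rw [show 2 * ν + ε - k - 1 = ν + ε + (ν - 1 - k) by ring, h1,
    show k - 1 = ν + ε + (ν - 1 - (2 * ν + ε - k)) by ring, h2]
  ring_nf

/-- The common factor of the generating series of the contiguous `magic` functions. -/
noncomputable def magicCore (p : Rˣ) (ν k ε : ℤ) : PowerSeries R :=
  chooseSeries p (k - 2) 3 * chooseSeries p (ν - 2 - k) (-3 * (2 * k - 3 * ν - 2 * ε) + 3)

/-- Splitting the smallest exponent off both series leaves the core. Splitting the largest exponent
off the series rescaled by t ↦ p ^ 6 t leaves the same core, as used in `pPow_mul_magic_eq_core`. -/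
theorem magic_eq_core (p : Rˣ) (ν k : ℤ) (β : ℕ) (ε : ℤ) :
    magic p ν k β ε = coeff β (magicCore p ν k ε *
      (linearSeries p (-3 * (k - 2)) * linearSeries p (-3 * (k - 2 * ν - 2 * ε - 2)))) := by
  have f := chooseSeries_succ' p (k - 2) 0
  have s := chooseSeries_succ' p (ν - 2 - k) (-3 * (2 * k - 3 * ν - 2 * ε))
  rw [magic_eq_coeff, show k - 1 = k - 2 + 1 by ring, show ν - 1 - k = ν - 2 - k + 1 by ring, f, s,
    magicCore]
  ring_nf

theorem pPow_mul_magic_eq_core (p : Rˣ) (ν k : ℤ) (β : ℕ) (ε : ℤ) :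
    pPow p (6 * β) * magic p ν k β ε = coeff β (magicCore p ν k ε *
      (linearSeries p (3 * k) * linearSeries p (-3 * (3 * k - 4 * ν - 2 * ε)))) := by
  have f := chooseSeries_succ p (k - 2) 6
  have s := chooseSeries_succ p (ν - 2 - k) (-3 * (2 * k - 3 * ν - 2 * ε) + 6)
  rw [magic_eq_shift, show k - 1 = k - 2 + 1 by ring, show ν - 1 - k = ν - 2 - k + 1 by ring, f, s,
    magicCore]
  ring_nf

theorem magic_pred_pred_eq_core (p : Rˣ) (ν k : ℤ) (β : ℕ) (ε : ℤ) :
    pPow p (3 * β) * magic p (ν - 1) (k - 1) β ε =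
      coeff β (magicCore p ν k ε * linearSeries p (-3 * (k - 2 * ν - 2 * ε - 2))) := by
  have s := chooseSeries_succ' p (ν - 2 - k) (-3 * (2 * k - 3 * ν - 2 * ε))
  rw [magic_eq_shift, show ν - 1 - 1 - (k - 1) = ν - 2 - k + 1 by ring,
    show -3 * (2 * (k - 1) - 3 * (ν - 1) - 2 * ε) + 3 = -3 * (2 * k - 3 * ν - 2 * ε) by ring, s,
    magicCore]
  ring_nf

theorem magic_pred_eq_core (p : Rˣ) (ν k : ℤ) (β : ℕ) (ε : ℤ) :
    pPow p (6 * β) * magic p (ν - 1) k β (ε + 1) =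
      coeff β (magicCore p ν k ε * linearSeries p (3 * k)) := by
  have f := chooseSeries_succ p (k - 2) 6
  rw [magic_eq_shift, show k - 1 = k - 2 + 1 by ring, f, magicCore]
  ring_nf

theorem magic_pred_pred_succ_eq_core (p : Rˣ) (ν k : ℤ) (β : ℕ) (ε : ℤ) :
    pPow p (3 * β) * magic p (ν - 1) (k - 1) β (ε + 1) =
      coeff β (magicCore p ν k ε * linearSeries p (-3 * (3 * k - 4 * ν - 2 * ε))) := by
  have s := chooseSeries_succ p (ν - 2 - k) (-3 * (2 * k - 3 * ν - 2 * ε) + 6)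
  rw [magic_eq_shift, show ν - 1 - 1 - (k - 1) = ν - 2 - k + 1 by ring,
    show -3 * (2 * (k - 1) - 3 * (ν - 1) - 2 * (ε + 1)) + 3 =
      -3 * (2 * k - 3 * ν - 2 * ε) + 6 by ring, s, magicCore]
  ring_nf

/-- With A, B, U, V for the powers of p: (1 + At)(1 + Ut) - (1 + Bt)(1 + Vt) = t ((A - B)(1 + Ut) +
(U - V)(1 + Bt)). -/
theorem coeff_succ_linearSeries (p : Rˣ) (h : PowerSeries R) (n : ℕ) (x y u v : ℤ) :
    coeff (n + 1) (h * (linearSeries p x * linearSeries p u)) -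
        coeff (n + 1) (h * (linearSeries p y * linearSeries p v)) =
      (pPow p x - pPow p y) * coeff n (h * linearSeries p u) +
        (pPow p u - pPow p v) * coeff n (h * linearSeries p y) := by
  rw [← coeff_C_mul, ← coeff_C_mul, ← map_add, ← map_sub, ← coeff_succ_mul_X n]
  congr 1
  simp only [linearSeries, map_sub]
  ring

/-- Comparing a coefficient before and after t ↦ p ^ 6 t produces 1 - p ^ (6 (β + 1)), the new
factor of ρ'(β + 1). The two ways of pairing the linear factors give this relation and
`magic_contiguous_right`. The free x only scales the relation, so that exponents can be matched
later. -/
theorem magic_contiguous_left (p : Rˣ) (ν k : ℤ) (β : ℕ) (ε x : ℤ) :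
    (pPow p x - pPow p (x + 6 * (β + 1))) * magic p ν k (β + 1) ε =
      (pPow p (x + 3 * β - 3 * (k - 2)) - pPow p (x + 3 * β + 3 * k)) *
        magic p (ν - 1) (k - 1) β ε +
      (pPow p (x + 6 * β - 3 * (k - 2 * ν - 2 * ε - 2)) -
        pPow p (x + 6 * β - 3 * (3 * k - 4 * ν - 2 * ε))) * magic p (ν - 1) k β (ε + 1) := by
  have h := coeff_succ_linearSeries p (magicCore p ν k ε) β (-3 * (k - 2)) (3 * k)
    (-3 * (k - 2 * ν - 2 * ε - 2)) (-3 * (3 * k - 4 * ν - 2 * ε))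
  rw [← magic_eq_core, ← pPow_mul_magic_eq_core, ← magic_pred_pred_eq_core,
    ← magic_pred_eq_core] at h
  push_cast at h
  simp only [sub_eq_add_neg (x + _), pPow_add, ← neg_mul]
  linear_combination (pPow p x) * h

theorem magic_contiguous_right (p : Rˣ) (ν k : ℤ) (β : ℕ) (ε x : ℤ) :
    (pPow p x - pPow p (x + 6 * (β + 1))) * magic p ν k (β + 1) ε =
      (pPow p (x + 3 * β - 3 * (k - 2)) - pPow p (x + 3 * β - 3 * (3 * k - 4 * ν - 2 * ε))) *
        magic p (ν - 1) (k - 1) β ε +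
      (pPow p (x + 3 * β - 3 * (k - 2 * ν - 2 * ε - 2)) - pPow p (x + 3 * β + 3 * k)) *
        magic p (ν - 1) (k - 1) β (ε + 1) := by
  have h := coeff_succ_linearSeries p (magicCore p ν k ε) β (-3 * (k - 2))
    (-3 * (3 * k - 4 * ν - 2 * ε)) (-3 * (k - 2 * ν - 2 * ε - 2)) (3 * k)
  rw [mul_comm (linearSeries p (-3 * (3 * k - 4 * ν - 2 * ε))), ← magic_eq_core,
    ← pPow_mul_magic_eq_core, ← magic_pred_pred_eq_core, ← magic_pred_pred_succ_eq_core] at h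
  push_cast at h
  simp only [sub_eq_add_neg (x + _), pPow_add, ← neg_mul]
  linear_combination (pPow p x) * h

/-- Up to a common factor the three series are linear in t, and (B - C)(1 + At) + (A - B)(1 + Ct) =
(A - C)(1 + Bt). -/
theorem magic_contiguous_shift (p : Rˣ) (ν k : ℤ) (β : ℕ) (ε x : ℤ) :
    (pPow p (x + 3 * β - 3 * (k - 2 * ν - 2 * ε - 1)) -
        pPow p (x + 3 * β - 3 * (3 * k - 4 * ν - 2 * ε - 1))) * magic p ν k β ε +
      (pPow p (x - 3 * (1 - k)) - pPow p (x - 3 * (k - 2 * ν - 2 * ε - 1))) *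
        magic p ν (k - 1) β ε =
      (pPow p (x - 3 * (1 - k)) - pPow p (x - 3 * (3 * k - 4 * ν - 2 * ε - 1))) *
        magic p ν (k - 1) β (ε - 1) := by
  have f := chooseSeries_succ p (k - 2) 3
  have s1 := chooseSeries_succ p (ν - 1 - k) (-3 * (2 * k - 3 * ν - 2 * ε) + 6)
  have s2 := chooseSeries_succ' p (ν - 1 - k) (-3 * (2 * k - 3 * ν - 2 * ε))
  have h : (pPow p (-3 * (k - 2 * ν - 2 * ε - 1)) - pPow p (-3 * (3 * k - 4 * ν - 2 * ε - 1))) *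
        (pPow p (3 * β) * magic p ν k β ε) +
      (pPow p (-3 * (1 - k)) - pPow p (-3 * (k - 2 * ν - 2 * ε - 1))) *
        magic p ν (k - 1) β ε =
      (pPow p (-3 * (1 - k)) - pPow p (-3 * (3 * k - 4 * ν - 2 * ε - 1))) *
        magic p ν (k - 1) β (ε - 1) := by
    rw [magic_eq_shift, magic_eq_coeff, magic_eq_coeff, ← coeff_C_mul, ← coeff_C_mul,
      ← coeff_C_mul, ← map_add]
    congr 1
    rw [show k - 1 - 1 = k - 2 by ring, show k - 1 = k - 2 + 1 by ring,
      show ν - 1 - (k - 2 + 1) = ν - 1 - k + 1 by ring,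
      show -3 * (2 * (k - 2 + 1) - 3 * ν - 2 * ε) = -3 * (2 * k - 3 * ν - 2 * ε) + 6 by ring,
      show -3 * (2 * (k - 2 + 1) - 3 * ν - 2 * (ε - 1)) = -3 * (2 * k - 3 * ν - 2 * ε) by ring,
      f, s1, s2]
    simp only [linearSeries, map_sub]
    ring_nf
  simp only [sub_eq_add_neg x, sub_eq_add_neg (x + _), pPow_add, ← neg_mul]
  linear_combination (pPow p x) * h

end ChooseSeries

/-! ### Transfer of the recursion to values with sign and constant removed. -/

section Recursion

variable {R : Type*} [CommRing R]

theorem zOf_coe (p : Rˣ) : ((zOf p : Rˣ) : R) = pPow p 2 := rfl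

theorem zOf_pow (p : Rˣ) (n : ℕ) : ((zOf p ^ n : Rˣ) : R) = pPow p (2 * n) := by
  rw [← zOf_zpow, zpow_natCast]

theorem pPow_mul_cancel_left (p : Rˣ) (n : ℤ) {x y : R} (h : pPow p n * x = pPow p n * y) :
    x = y :=
  (p ^ n).isUnit.mul_left_cancel h

theorem zmod_three_cases (i : ZMod 3) : i = 1 ∨ i = 2 ∨ i = 0 := by
  revert i
  decide

/-- One anchor c suffices: z is a unit, so the equation can be run upwards and downwards. -/
theorem eq_of_difference_eq (p : Rˣ) {u v : ℕ → R} {N c : ℕ} (hc : 0 < c) (hcN : c ≤ N)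
    (hd : ∀ k, 0 < k → k < N → u (k + 1) - pPow p 2 * u k = v (k + 1) - pPow p 2 * v k)
    (huv : u c = v c) {k : ℕ} (hk : 0 < k) (hkN : k ≤ N) : u k = v k := by
  rcases le_total c k with h | h
  · induction k, h using Nat.le_induction with
    | base => exact huv
    | succ n hn ih =>
      have h1 := ih (by omega) (by omega)
      have h2 := hd n (by omega) (by omega)
      rw [h1] at h2
      linear_combination h2
  · induction h using Nat.decreasingInduction with
    | self => exact huv
    | of_succ n hn ih =>
      have h1 := ih (by omega) (by omega)
      have h2 := hd n (by omega) (by omega)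
      rw [h1] at h2
      refine pPow_mul_cancel_left p 2 ?_
      linear_combination -h2

/-- The recursion of `XiRecursion` for values of the form `(-1) ^ k * (c * u i k)` on the old side
and `(-1) ^ k * (c * t * v i k)` on the new side, where `u` and `v` are defined for all integers
`k`. The sign `σ` is `(-1) ^ L`, and `e₁, e₂, e'` record the values at the two ends. -/
structure XiStep (p : Rˣ) (L : ℤ) (σ t : R) (u v : ZMod 3 → ℤ → R) (e₁ e₂ e' : R) : Prop where
  one : ∀ k, t * (v 1 (k + 1) + pPow p 2 * v 1 k) =
    -(u 2 k + σ * (pPow p (2 * (2 * k - L)) * u 2 (L - k)))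
  two : ∀ k, t * v 2 k = u 0 k + σ * (pPow p (2 * (L - k)) * u 1 (L - k))
  zero : ∀ k, pPow p 2 * (t * v 0 (k + 1)) = u 1 k + σ * (pPow p (-2 * k) * u 0 (L - k))
  last : u 1 0 + σ * u 0 L = e₁
  edge : pPow p 2 * (t * e') = -(t * v 1 1) - e₂
  balanced : ∀ k, k + k = L + 1 → v 1 k = 0
  centre : ∀ k, k + k = L → t * v 1 (k + 1) = -u 2 k

/-- The functions u i need not give the true scalars at k = 0 and k = L. The field `last` says that
the combination entering there equals the true boundary value e₁; e₂ records the right side of the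
difference equation at k = 0. -/
theorem XiRecursion.values {p : Rˣ} {L : ℕ} {X Y : ZMod 3 → ℕ → R}
    (hL0 : 0 < L) (H : XiRecursion (zOf p) L X Y) {c σ t e₁ e₂ e' : R} {u v : ZMod 3 → ℤ → R}
    (S : XiStep p L σ t u v e₁ e₂ e') (hσ : (-1) ^ L = σ)
    (hX : ∀ i k, 0 < k → k < L → X i k = (-1) ^ k * (c * u i k)) (h₁ : X 0 L = c * e₁)
    (h₂ : X 2 0 + pPow p (-2 * L) * X 2 L = c * e₂) :
    (∀ i k, 0 < k → k < L + 1 → Y i k = (-1) ^ k * (c * t * v i k)) ∧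
      Y 0 (L + 1) = c * t * e' := by
  have hL : (-1 : R) ^ L * (-1) ^ L = 1 := by rw [← mul_pow, neg_one_mul, neg_neg, one_pow]
  have hs : ∀ {k m : ℕ}, k + m = L → (-1 : R) ^ m = σ * (-1) ^ k := by
    intro k m h
    have hk : (-1 : R) ^ k * (-1) ^ k = 1 := by rw [← mul_pow, neg_one_mul, neg_neg, one_pow]
    rw [← hσ, ← h, pow_add]
    linear_combination -(-1) ^ m * hk
  have hz : (pPow p 0 : R) = 1 := pPow_zero p
  have v1 : ∀ k, 0 < k → k ≤ L → Y 1 k = (-1) ^ k * (c * t * v 1 k) := by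
    have hd : ∀ k, 0 < k → k < L → Y 1 (k + 1) - pPow p 2 * Y 1 k =
        (-1) ^ (k + 1) * (c * t * v 1 ((k + 1 : ℕ) : ℤ)) -
          pPow p 2 * ((-1) ^ k * (c * t * v 1 k)) := by
      intro k hk hkL
      obtain ⟨m, rfl⟩ := Nat.exists_eq_add_of_le hkL.le
      have h := H.one k m rfl
      have V := S.one k
      rw [hX 2 k hk hkL, hX 2 m (by omega) (by omega), zOf_zpow, zOf_coe, hs rfl] at h
      push_cast at V ⊢
      rw [add_sub_cancel_left, show 2 * (2 * (k : ℤ) - (k + m)) = 2 * (k - m) by ring] at V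
      rw [pow_succ]
      linear_combination h + (-1) ^ k * c * V
    intro k hk hkL
    -- The parity of L selects the anchor: a value inherited from the old word for L even, a zero
    -- for L odd.
    rcases Nat.even_or_odd' L with ⟨m, hm | hm⟩
    · refine eq_of_difference_eq (v := fun k => (-1) ^ k * (c * t * v 1 k)) p
        (c := m + 1) (by omega) (by omega) hd ?_ hk hkL
      have V := S.centre m (by omega)
      rw [H.one_centre m (by omega), hX 2 m (by omega) (by omega), pow_succ]
      push_cast
      linear_combination (-1) ^ m * c * V
    · refine eq_of_difference_eq (v := fun k => (-1) ^ k * (c * t * v 1 k)) p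
        (c := m + 1) (by omega) (by omega) hd ?_ hk hkL
      rw [H.one_balanced (m + 1) (by omega), S.balanced _ (by push_cast; omega), mul_zero, mul_zero]
  refine ⟨fun i k hk hkl => ?_, ?_⟩
  · rcases zmod_three_cases i with rfl | rfl | rfl
    · exact v1 k hk (by omega)
    · have V := S.two k
      rcases Nat.lt_or_ge k L with hlt | hge
      · obtain ⟨m, rfl⟩ := Nat.exists_eq_add_of_le hlt.le
        push_cast at V
        rw [add_sub_cancel_left] at V
        rw [H.two k m rfl hk (by omega), hX 0 k hk hlt, hX 1 m (by omega) (by omega), zOf_pow,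
          hs rfl]
        linear_combination -(-1) ^ k * c * V
      · obtain rfl : k = L := by omega
        rw [sub_self, mul_zero, hz] at V
        rw [H.two_last, h₁, ← S.last]
        subst hσ
        linear_combination -(-1) ^ k * c * V - c * u 1 0 * hL
    · obtain ⟨k, rfl⟩ := Nat.exists_eq_succ_of_ne_zero hk.ne'
      refine pPow_mul_cancel_left p 2 ?_
      have V := S.zero k
      rw [Nat.succ_eq_add_one, pow_succ]
      push_cast
      rcases Nat.eq_zero_or_pos k with rfl | hk0
      · have h := H.zero_first
        rw [h₁, ← S.last, zOf_coe] at h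
        rw [Nat.cast_zero, mul_zero, hz, sub_zero] at V
        linear_combination -h + c * V
      · obtain ⟨m, rfl⟩ := Nat.exists_eq_add_of_le (show k ≤ L by omega)
        have h := H.zero k m rfl hk0 (by omega)
        rw [hX 1 k hk0 (by omega), hX 0 m (by omega) (by omega), zOf_zpow, zOf_coe, hs rfl,
          mul_neg, ← neg_mul] at h
        push_cast at V
        rw [add_sub_cancel_left] at V
        linear_combination -h + (-1) ^ k * c * V
  -- At k = 0 the difference equation links the known Y 1 1 to Y 1 0, which is a rotation of the
  -- boundary value sought.
  · have h := H.one 0 L (zero_add L)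
    have V := S.edge
    refine pPow_mul_cancel_left p 2 ?_
    rw [zero_add, v1 1 one_pos hL0, H.edge, zOf_zpow, zOf_coe, Nat.cast_zero, zero_sub, mul_neg,
      ← neg_mul, h₂] at h
    push_cast at h
    linear_combination -h - c * V

/-- The values `Ξ(a, b, i, k)` for `0 < k < ℓ` are `(-1) ^ k * (c * u i k)`, and
`Ξ(a, b, 3, ℓ) = c * e`. -/
def HasXiValues (p : Rˣ) (a b : ℕ) (c : R) (u : ZMod 3 → ℤ → R) (e : R) : Prop :=
  (∀ i k, 0 < k → k < a + b + 1 → Xi (zOf p) a b i k = (-1) ^ k * (c * u i k)) ∧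
    Xi (zOf p) a b 0 (a + b + 1) = c * e

theorem HasXiValues.succ {p : Rˣ} {a b L : ℕ} {c c' σ t e e' : R} {u v : ZMod 3 → ℤ → R}
    (H : HasXiValues p a b c u e) (S : XiStep p L σ t u v e (-(pPow p (2 * L) * e)) e')
    (hL : a + b + 1 = L) (hσ : (-1) ^ L = σ) (hc : c * t = c') :
    HasXiValues p a (b + 1) c' v e' := by
  subst hL hc
  refine XiRecursion.values (by omega) (xiRecursion_succ (zOf p) a b) S hσ H.1 H.2 ?_
  rw [Xi_zero_right, Xi_two_length, show (2 : ZMod 3) + 2 = 1 by decide, Xi_one_length, H.2,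
    zOf_pow]
  ring

theorem HasXiValues.base_succ {p : Rˣ} {a L : ℕ} {c c' σ t e e' : R} {u v : ZMod 3 → ℤ → R}
    (H : HasXiValues p a 0 c u e)
    (S : XiStep p L σ t (fun i => u (i + 1)) v (-(pPow p (2 * L) * e)) (pPow p (-2 * L) * e) e')
    (hL : a + 1 = L) (hσ : (-1) ^ L = σ) (hc : c * t = c') :
    HasXiValues p (a + 1) 0 c' v e' := by
  subst hL hc
  have h1 := Xi_one_length (R := R) (zOf p) a 0
  have h2 := Xi_two_length (R := R) (zOf p) a 0
  rw [H.2, zOf_pow] at h1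
  refine XiRecursion.values (by omega) (xiRecursion_succ_zero (zOf p) a) S hσ
    (fun i => H.1 (i + 1)) ?_ ?_
  · rw [zero_add]
    exact h1.trans (by ring)
  · rw [Xi_zero_right, show (2 : ZMod 3) + 1 = 0 by decide, zero_add, h2, zero_add]
    exact (congrArg _ H.2).trans (by ring)

/-- No k satisfies 0 < k < 1, so u is arbitrary; the content is ∂₀ x₁ = -z⁻¹. -/
theorem hasXiValues_zero_zero (p : Rˣ) (u : ZMod 3 → ℤ → R) :
    HasXiValues p 0 0 1 u (-pPow p (-2)) := by
  refine ⟨fun i k hk hkl => by omega, ?_⟩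
  have hw : wordABI 0 0 0 = [] ++ [0] := by simp [wordABI]
  have h := demazureValue_append_zero_first (R := R) (zOf p) [] 0
  rw [← hw, ← pow_one (MvPolynomial.X 1), ← Xi_eq_demazureValue (zOf p) 0 0 0 (add_zero _),
    pow_zero, zOf_coe] at h
  have h1 : demazureValue (R := R) (zOf p) [] 1 = 1 := by simp [demazureValue, demazureWord]
  have h2 : (pPow p 2 * pPow p (-2) : R) = 1 := by
    rw [← pPow_add, add_neg_cancel, pPow_zero]
  refine pPow_mul_cancel_left p 2 ?_
  rw [h1] at h
  linear_combination -h + h2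

end Recursion

/-! ### The closed values by parity of a and b. -/

section ClosedValues

variable {R : Type*} [CommRing R]

/-- The part of the exponent of `p` in the closed formula that does not depend on the parities of
`a` and `b` or on `i`. -/
def baseExponent (l β k : ℤ) : ℤ :=
  2 * k - 3 * (k * (k - β - l)) + β * (β - 1) - l * (l + 1) - (β + 1) * (l + 3 * β)

/-- The part of the exponent of `p` in the closed formula that depends on `i`. -/
def indexExponent (l k : ℤ) (i : ZMod 3) : ℤ :=
  if i = 1 then 0 else if i = 2 then 2 * l - 6 * k else -2 * l

/-- `q ^ n - q ^ (-n)`. -/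
def qSub (p : Rˣ) (n : ℤ) : R := pPow p (-3 * n) - pPow p (3 * n)

/-- The exponent of `p` in the closed formula for `a = 2 α + 1` and `b = 2 β + 1`. -/
def oddOddExponent (α β : ℤ) (i : ZMod 3) (k : ℤ) : ℤ :=
  let l := 2 * α + 2 * β + 3
  baseExponent l β k + indexExponent l k i + 2 * β + 2 * (l + 1) - (β + 3)

/-- The exponent of `p` in the closed formula for `a = 2 α + 2` and `b = 2 β + 1`. -/
def evenOddExponent (α β : ℤ) (i : ZMod 3) (k : ℤ) : ℤ :=
  let l := 2 * α + 2 * β + 4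
  baseExponent l β k + indexExponent l k i - 2 * β - 6 + 2 * (l + 1) + 3 * (α + β + 2)

/-- The closed formula without sign and `ρ'` factors, for `a = 2 α + 1` and `b = 2 β + 1`. -/
def oddOddValue (p : Rˣ) (α : ℤ) (β : ℕ) (i : ZMod 3) (k : ℤ) : R :=
  pPow p (oddOddExponent α β i k) * magic p (α + β + 2) k β (-1)

/-- The closed formula without sign and `ρ'` factors, for `a = 2 α + 2` and `b = 2 β + 1`. -/
def evenOddValue (p : Rˣ) (α : ℤ) (β : ℕ) (i : ZMod 3) (k : ℤ) : R :=
  pPow p (evenOddExponent α β i k) * qSub p (k - (α + β + 2)) * magic p (α + β + 2) k β 0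

/-- The closed formula without sign and `ρ'` factors, for `a = 2 α + 1` and `b = 2 β + 2`. -/
def oddEvenValue (p : Rˣ) (α : ℤ) (β : ℕ) (i : ZMod 3) (k : ℤ) : R :=
  let l := 2 * α + 2 * β + 4
  let ν := α + β + 2
  let e := baseExponent l β k + indexExponent l k i + 2 * β
  if i = 1 then pPow p (e + 3 * ν) * qSub p (ν - k) * magic p ν k β 0
  else if i = 2 then pPow p (e + 3 * (l - 1)) * qSub p (l - 1 - k) * magic p ν k β (-1)
  else pPow p (e + 3 * (l - 1) - 3 * β) * qSub p (1 - k) * magic p ν (k - 1) β (-1)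

/-- The closed formula without sign and `ρ'` factors, for `a = 2 α + 2` and `b = 2 β + 2`. -/
def evenEvenValue (p : Rˣ) (α : ℤ) (β : ℕ) (i : ZMod 3) (k : ℤ) : R :=
  let l := 2 * α + 2 * β + 5
  let ν := α + β + 2
  let e := baseExponent l β k + indexExponent l k i - 2 * β - 6 + (β + 3)
  if i = 1 then
    pPow p (e + 3 * l) * qSub p (k - ν) * qSub p (ν + 1 - k) * magic p ν k β 1
  else if i = 2 then
    pPow p (e + 3 * (l + ν - 1)) * qSub p (k - ν) * qSub p (l - 1 - k) * magic p ν k β 0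
  else
    pPow p (e + 3 * (l + ν - 1) - 3 * β) * qSub p (k - 1) * qSub p (ν + 1 - k) *
      magic p ν (k - 1) β 0

/-- The values for `b = 0` and `a = 2 α + 1`, without sign and `ρ'` factor. -/
def baseOddValue (p : Rˣ) (α : ℤ) (i : ZMod 3) (k : ℤ) : R :=
  if i = 1 then 0
  else if i = 2 then -pPow p (-3 * k ^ 2 + (6 * α + 5) * k - (2 * α + 1) * (2 * α + 2))
  else pPow p (-3 * k ^ 2 + (6 * α + 5) * k - (2 * α + 2) ^ 2)

/-- The values for `b = 0` and `a = 2 α + 2`, without sign and `ρ'` factor. -/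
def baseEvenValue (p : Rˣ) (α : ℤ) (i : ZMod 3) (k : ℤ) : R :=
  if i = 1 then -pPow p (-3 * k ^ 2 + (6 * α + 11) * k - (2 * α + 3) * (2 * α + 4))
  else if i = 2 then -pPow p (-3 * k ^ 2 + (6 * α + 5) * k - 4 * α * (α + 1))
  else -pPow p (-3 * k ^ 2 + (6 * α + 11) * k - (4 * α ^ 2 + 12 * α + 12))

/-! ### Verification that the closed values satisfy the recursion. -/

theorem zmod_three_ne : (2 : ZMod 3) ≠ 1 ∧ (0 : ZMod 3) ≠ 1 ∧ (0 : ZMod 3) ≠ 2 := by decide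

theorem zmod_three_add_one : (1 : ZMod 3) + 1 = 2 ∧ (2 : ZMod 3) + 1 = 0 := by decide

theorem magic_zero (p : Rˣ) (ν k ε : ℤ) : (magic p ν k 0 ε : R) = 1 := by
  simp [magic, qPow_eq, pPow_zero, quantumChoose_zero_right]

/-- The values for `b = 0` and `a = 2 α + 1` at `k = ℓ`, without the `ρ'` factor. -/
def baseOddEdge (p : Rˣ) (α : ℤ) : R := pPow p (-((2 * α + 2) * (2 * α + 3)))

/-- The values for `b = 0` and `a = 2 α + 2` at `k = ℓ`, without the factor `ρ'(α)`. -/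
def baseEvenEdge (p : Rˣ) (α : ℤ) : R :=
  pPow p (6 * (α + 1) - (2 * α + 3) * (2 * α + 4)) - pPow p (-((2 * α + 3) * (2 * α + 4)))

/-- The old values are vacuous here; they are chosen to make the identities hold for every integer
k. -/
theorem xiStep_baseOdd_zero (p : Rˣ) :
    XiStep p 1 (-1) 1
      (fun i k => if i + 1 = 1 then baseOddValue p 0 2 k else 0)
      (baseOddValue p 0) (-(pPow p (2 * 1) * -pPow p (-2))) (pPow p (-2 * 1) * -pPow p (-2))
      (baseOddEdge (R := R) p 0) := by
  constructor
  all_goals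
    intros
    simp [baseOddValue, baseOddEdge, zmod_three_ne, zmod_three_add_one, ← pPow_add]
  all_goals ring_nf

theorem xiStep_baseEven (p : Rˣ) (α : ℤ) :
    XiStep p (2 * α + 2) 1 1 (fun i => baseOddValue p α (i + 1)) (baseEvenValue p α)
      (-(pPow p (2 * (2 * α + 2)) * baseOddEdge p α))
      (pPow p (-2 * (2 * α + 2)) * baseOddEdge p α) (baseEvenEdge (R := R) p α) := by
  constructor
  case balanced => intros; omega
  all_goals
    first
    | intro k h; obtain rfl : k = α + 1 := by omega
    | intros
    simp only [baseOddValue, baseEvenValue, baseOddEdge, baseEvenEdge, zmod_three_ne,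
      zmod_three_add_one, zero_add, if_true, if_false, one_mul, neg_mul, mul_neg, mul_add, mul_sub,
      ← pPow_add]
  all_goals ring_nf

/-- For the letters 2 and 0 the two old monomials have opposite signs and ratio p ^ (6 (α + 1)),
which yields the new factor of ρ'(α + 1). -/
theorem xiStep_baseOdd_succ (p : Rˣ) (α : ℤ) :
    XiStep p (2 * α + 3) (-1) (1 - pPow p (6 * (α + 1))) (fun i => baseEvenValue p α (i + 1))
      (baseOddValue p (α + 1)) (-(pPow p (2 * (2 * α + 3)) * baseEvenEdge p α))
      (pPow p (-2 * (2 * α + 3)) * baseEvenEdge p α) (baseOddEdge (R := R) p (α + 1)) := by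
  constructor
  case centre => intros; omega
  all_goals
    intros
    simp only [baseOddValue, baseEvenValue, baseOddEdge, baseEvenEdge, zmod_three_ne,
      zmod_three_add_one, zero_add, if_true, if_false, one_mul, neg_mul, mul_neg, mul_add, mul_sub,
      sub_mul, ← pPow_add]
  all_goals ring_nf

theorem xiStep_oddOdd_zero (p : Rˣ) (α : ℤ) :
    XiStep p (2 * α + 2) 1 1 (baseOddValue p α) (oddOddValue p α 0) (baseOddEdge p α)
      (-(pPow p (2 * (2 * α + 2)) * baseOddEdge p α)) (0 : R) := by
  constructor
  case balanced => intros; omega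
  all_goals
    first
    | intro k h; obtain rfl : k = α + 1 := by omega
    | intros
    simp only [baseOddValue, oddOddValue, oddOddExponent, baseExponent, indexExponent, baseOddEdge,
      magic_zero, zmod_three_ne, if_true, if_false, one_mul, mul_one, neg_mul, mul_neg, mul_add,
      Nat.cast_zero, ← pPow_add]
  all_goals ring_nf

theorem xiStep_evenOdd_zero (p : Rˣ) (α : ℤ) :
    XiStep p (2 * α + 3) (-1) 1 (baseEvenValue p α) (evenOddValue p α 0) (baseEvenEdge p α)
      (-(pPow p (2 * (2 * α + 3)) * baseEvenEdge p α)) (0 : R) := by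
  constructor
  case centre => intros; omega
  all_goals
    first
    | intro k h; obtain rfl : k = α + 2 := by omega
    | intros
    simp only [baseEvenValue, evenOddValue, evenOddExponent, baseExponent, indexExponent, qSub,
      baseEvenEdge, magic_zero, zmod_three_ne, if_true, if_false, one_mul, mul_one, neg_mul,
      mul_neg, mul_add, mul_sub, Nat.cast_zero, ← pPow_add]
  all_goals ring_nf

/-- Since L = 2ν - 1, the reflection with ε = -1 exchanges k and L - k. For the letters 2 and 0 it
merges the two terms into one `qSub`; only the letter 1 needs a contiguous relation. -/
theorem xiStep_oddEven (p : Rˣ) (α : ℤ) (β : ℕ) :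
    XiStep p (2 * α + 2 * β + 3) (-1) 1 (oddOddValue p α β) (oddEvenValue p α β)
      0 (-(pPow p (2 * (2 * α + 2 * β + 3)) * 0))
      (-(pPow p (-2) * oddEvenValue (R := R) p α β 1 1)) := by
  have r (k : ℤ) := magic_reflect p (ν := α + β + 2) (m := 2 * α + 2 * β + 3 - k) (k := k)
    (ε := -1) β (by ring)
  have w (k : ℤ) := magic_contiguous_shift p (α + β + 2) (k + 1) β 0
    (baseExponent (2 * α + 2 * β + 4) β (k + 1) + 6 * k - 6 * (α + β + 2) - β + 3)
  have r0 := r 0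
  rw [sub_zero] at r0
  constructor
  case centre => intros; omega
  all_goals
    first
    | intro k h; obtain rfl : k = α + β + 2 := by omega
    | intros
    simp only [oddOddValue, oddEvenValue, oddOddExponent, baseExponent, indexExponent, qSub,
      zmod_three_ne, if_true, if_false, r, r0, one_mul, neg_mul, mul_neg, mul_add, mul_sub, sub_mul,
      ← mul_assoc, ← pPow_add] at w ⊢
  case one k => linear_combination (norm := ring_nf) w k
  all_goals ring_nf

theorem xiStep_evenEven (p : Rˣ) (α : ℤ) (β : ℕ) :
    XiStep p (2 * α + 2 * β + 4) 1 1 (evenOddValue p α β) (evenEvenValue p α β)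
      0 (-(pPow p (2 * (2 * α + 2 * β + 4)) * 0))
      (-(pPow p (-2) * evenEvenValue (R := R) p α β 1 1)) := by
  have r (k : ℤ) := magic_reflect p (ν := α + β + 2) (m := 2 * α + 2 * β + 4 - k) (k := k)
    (ε := 0) β (by ring)
  have w (k d : ℤ) := magic_contiguous_shift p (α + β + 2) (k + 1) β 1
    (baseExponent (2 * α + 2 * β + 5) β (k + 1) + d - 4 * β - 3)
  have r0 := r 0
  rw [sub_zero] at r0
  constructor
  case balanced => intros; omega
  all_goals
    first
    | intro k h; obtain rfl : k = α + β + 2 := by omega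
    | intros
    simp only [evenOddValue, evenEvenValue, evenOddExponent, baseExponent, indexExponent, qSub,
      zmod_three_ne, if_true, if_false, r, r0, one_mul, neg_mul, mul_neg, mul_add, mul_sub, sub_mul,
      ← mul_assoc, ← pPow_add] at w ⊢
  -- The values share a factor `qSub p (k - ν)` up to sign; being a difference of two powers of p,
  -- it makes the relation enter twice.
  case one k =>
    linear_combination (norm := ring_nf) w k (3 * k) - w k (9 * k - 6 * (α + β + 2))
  all_goals ring_nf

/-- The letter 2 is the left relation, the letter 0 the right one, and the letter 1 their sum, in
which the terms with ε = 0 cancel. The factor t is what (-1) ^ β ρ'(β) gains when β grows by one. -/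
theorem xiStep_oddOdd_succ (p : Rˣ) (α : ℤ) (β : ℕ) :
    XiStep p (2 * α + 2 * β + 4) 1 (-(1 - pPow p (6 * (β + 1)))) (oddEvenValue p α β)
      (oddOddValue p α (β + 1)) (-(pPow p (-2) * oddEvenValue p α β 1 1))
      (-(pPow p (2 * (2 * α + 2 * β + 4)) * -(pPow p (-2) * oddEvenValue p α β 1 1))) (0 : R) := by
  have r (k : ℤ) := magic_reflect p (ν := α + β + 2) (m := 2 * α + 2 * β + 4 - k) (k := k)
    (ε := 0) β (by ring)
  have r' (k : ℤ) := magic_reflect p (ν := α + β + 2) (m := 2 * α + 2 * β + 4 - k - 1) (k := k)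
    (ε := -1) β (by ring)
  have r'' (k : ℤ) := magic_reflect p (ν := α + β + 2) (m := 2 * α + 2 * β + 4 - k) (k := k - 1)
    (ε := -1) β (by ring)
  have wl (k d : ℤ) := magic_contiguous_left p (α + β + 3) k β (-1)
    (oddOddExponent α (β + 1) 1 k + d)
  have wr (k d : ℤ) := magic_contiguous_right p (α + β + 3) k β (-1)
    (oddOddExponent α (β + 1) 1 k + d)
  have ws := magic_contiguous_shift p (α + β + 2) 1 β 0
    (baseExponent (2 * α + 2 * β + 4) β 1 + 1 - β - 6 * (α + β + 2))
  constructor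
  case balanced => intros; omega
  all_goals
    first
    | intro k h; obtain rfl : k = α + β + 2 := by omega
    | intros
    simp only [oddOddValue, oddEvenValue, oddOddExponent, baseExponent, indexExponent, qSub,
      zmod_three_ne, if_true, if_false, r, r', r'', one_mul, neg_mul, mul_neg, mul_add, mul_sub,
      sub_mul, Nat.cast_add, Nat.cast_one, ← mul_assoc, ← pPow_add] at wl wr ws ⊢
  case one k => linear_combination (norm := ring_nf) -wl k 2 - wr (k + 1) 0
  case two k => linear_combination (norm := ring_nf) -wl k (2 * (2 * α + 2 * β + 5) - 6 * k)
  case zero k => linear_combination (norm := ring_nf) -wr (k + 1) (2 - 2 * (2 * α + 2 * β + 5))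
  -- Both boundary terms reflect to k = 0, and the shift relation moves them to k = 1.
  case last => linear_combination (norm := ring_nf) ws
  -- At k = 1 the first coefficient of the left relation vanishes.
  case edge => linear_combination (norm := ring_nf) -wl 1 0
  -- At k = α + β + 3 the second coefficient of the right relation vanishes.
  case centre =>
    linear_combination (norm := ring_nf) -wr (α + β + 3) 0

/-- The scheme of `xiStep_oddOdd_succ` with ε raised by one. The extra factor `qSub` is a difference
of two powers, so each relation is used with two shifts; the same factor gives the zero in
`balanced`. -/
theorem xiStep_evenOdd_succ (p : Rˣ) (α : ℤ) (β : ℕ) :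
    XiStep p (2 * α + 2 * β + 5) (-1) (-(1 - pPow p (6 * (β + 1)))) (evenEvenValue p α β)
      (evenOddValue p α (β + 1)) (-(pPow p (-2) * evenEvenValue p α β 1 1))
      (-(pPow p (2 * (2 * α + 2 * β + 5)) * -(pPow p (-2) * evenEvenValue p α β 1 1))) (0 : R) := by
  have r (k : ℤ) := magic_reflect p (ν := α + β + 2) (m := 2 * α + 2 * β + 5 - k) (k := k)
    (ε := 1) β (by ring)
  have r' (k : ℤ) := magic_reflect p (ν := α + β + 2) (m := 2 * α + 2 * β + 5 - k - 1) (k := k)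
    (ε := 0) β (by ring)
  have r'' (k : ℤ) := magic_reflect p (ν := α + β + 2) (m := 2 * α + 2 * β + 5 - k) (k := k - 1)
    (ε := 0) β (by ring)
  have wl (k d : ℤ) := magic_contiguous_left p (α + β + 3) k β 0
    (evenOddExponent α (β + 1) 1 k + d)
  have wr (k d : ℤ) := magic_contiguous_right p (α + β + 3) k β 0
    (evenOddExponent α (β + 1) 1 k + d)
  have ws (d : ℤ) := magic_contiguous_shift p (α + β + 2) 1 β 1
    (baseExponent (2 * α + 2 * β + 5) β 1 - 4 * β - 5 + d)
  constructor
  case centre => intros; omega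
  all_goals
    first
    | intro k h; obtain rfl : k = α + β + 3 := by omega
    | intros
    simp only [evenOddValue, evenEvenValue, evenOddExponent, baseExponent, indexExponent, qSub,
      zmod_three_ne, if_true, if_false, r, r', r'', one_mul, neg_mul, mul_neg, mul_add, mul_sub,
      sub_mul, Nat.cast_add, Nat.cast_one, ← mul_assoc, ← pPow_add] at wl wr ws ⊢
  case one k =>
    linear_combination (norm := ring_nf) wl k (3 * k - 3 * (α + β + 3) + 2) -
      wl k (3 * (α + β + 3) - 3 * k + 2) + wr (k + 1) (3 * k + 3 - 3 * (α + β + 3)) -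
      wr (k + 1) (3 * (α + β + 3) - 3 * k - 3)
  case two k =>
    linear_combination (norm := ring_nf) wl k (4 * α + 4 * β + 12 - 3 * k -
      3 * (α + β + 3)) - wl k (4 * α + 4 * β + 12 - 9 * k + 3 * (α + β + 3))
  case zero k =>
    linear_combination (norm := ring_nf) wr (k + 1) (3 * k - 7 - 4 * α - 4 * β -
      3 * (α + β + 3)) - wr (k + 1) (3 * (α + β + 3) - 3 * k - 13 - 4 * α - 4 * β)
  case last =>
    linear_combination (norm := ring_nf) ws 0 - ws (-6 * (α + β + 2))
  case edge =>
    linear_combination (norm := ring_nf) wl 1 (-3 * (α + β + 2)) -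
      wl 1 (3 * (α + β + 2))
  all_goals ring_nf

end ClosedValues

/-! ### The closed formula rewritten as sign, ρ' factors and closed value. -/

section ClosedForm

variable {R : Type*} [CommRing R]

/-- The right-hand side of the closed formula for `Ξ(a, b, i, k)`. -/
def closedForm (p : Rˣ) (a b : ℕ) (i : ZMod 3) (k : ℕ) : R :=
  mu b k * gamma1 p a b * gamma2 p a b i k * gamma3 p a b i k * kappa1 p a b k * kappa2 p i k *
    lambda1 p a b * lambda2 p a b * lambda3 p a b * lambda4 p a b * lambda5 p a b i

theorem odd_spec (n : ℕ) :
    Odd (2 * n + 1) ∧ ¬Even (2 * n + 1) ∧ halfPart (2 * n + 1) = n := by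
  have h := odd_two_mul_add_one n
  refine ⟨h, Nat.not_even_iff_odd.2 h, ?_⟩
  unfold halfPart
  omega

theorem even_spec (n : ℕ) :
    Even (2 * n + 2) ∧ ¬Odd (2 * n + 2) ∧ halfPart (2 * n + 2) = n := by
  have h : Even (2 * n + 2) := ⟨n + 1, by ring⟩
  refine ⟨h, Nat.not_odd_iff_even.2 h, ?_⟩
  unfold halfPart
  omega

theorem two_mul_choose_two (n : ℕ) : 2 * ((n.choose 2 : ℕ) : ℤ) = n * (n - 1) := by
  induction n with
  | zero => simp
  | succ n ih =>
    rw [Nat.choose_succ_succ' n 1, Nat.choose_one_right]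
    push_cast
    linear_combination ih

theorem kappa2_mul_lambda5 (p : Rˣ) (a b k : ℕ) (i : ZMod 3) :
    (kappa2 p i k * lambda5 p a b i : R) = pPow p (indexExponent (lengthOf a b) k i) := by
  rcases zmod_three_cases i with rfl | rfl | rfl <;>
    simp only [kappa2, lambda5, indexExponent, zmod_three_ne, zmod_three_ne.1.symm, if_true,
      if_false, qPow_eq, zPow_eq, ← pPow_add, pPow_zero, one_mul] <;>
    ring_nf

theorem kappa1_mul_lambda1 (p : Rˣ) (a b k : ℕ) :
    (kappa1 p a b k * lambda1 p a b : R) =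
      pPow p (baseExponent (lengthOf a b) (halfPart b) k) := by
  unfold kappa1 lambda1 baseExponent
  have h1 := two_mul_choose_two (halfPart b)
  have h2 := two_mul_choose_two (a + b + 2)
  rw [qPow_eq, zPow_eq, zPow_eq, zPow_eq, h1, mul_neg, h2, lengthOf]
  simp only [← mul_assoc, ← pPow_add]
  push_cast
  ring_nf

theorem closedForm_eq (p : Rˣ) (a b : ℕ) (i : ZMod 3) (k : ℕ) :
    (closedForm p a b i k : R) = (-1) ^ k *
      ((-1) ^ halfPart b * (rhoPrime p (halfPart a) * rhoPrime p (halfPart b)) *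
        (pPow p (baseExponent (lengthOf a b) (halfPart b) k) *
          pPow p (indexExponent (lengthOf a b) k i) *
          lambda2 p a b * lambda3 p a b * lambda4 p a b * gamma2 p a b i k *
          gamma3 p a b i k)) := by
  rw [← kappa2_mul_lambda5, ← kappa1_mul_lambda1, closedForm, mu, gamma1]
  ring

theorem mul_qDiff_mul_qInt (p : Rˣ) (x : R) (n : ℤ) :
    x * qDiff p * qInt p n = x * qSub p n := by
  rw [mul_assoc, qDiff_mul_qInt, qSub]

theorem mul_qDiff_sq_mul_qInt (p : Rˣ) (x : R) (m n : ℤ) :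
    x * qDiff p ^ 2 * qInt p m * qInt p n = x * qSub p m * qSub p n := by
  rw [← mul_qDiff_mul_qInt, ← mul_qDiff_mul_qInt]
  ring

theorem closedForm_odd_odd (p : Rˣ) (α β : ℕ) (i : ZMod 3) (k : ℕ) :
    (closedForm p (2 * α + 1) (2 * β + 1) i k : R) =
      (-1) ^ k * ((-1) ^ β * (rhoPrime p α * rhoPrime p β) * oddOddValue p α β i k) := by
  rw [closedForm_eq]
  simp only [odd_spec, lengthOf, lambda2, lambda3, lambda4, phiOf, nuOf, gamma2, gamma3,
    oddOddValue, oddOddExponent, zPow_eq, and_self, if_true, if_false, mul_one, ← pPow_add]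
  push_cast
  ring_nf

theorem closedForm_even_odd (p : Rˣ) (α β : ℕ) (i : ZMod 3) (k : ℕ) :
    (closedForm p (2 * α + 2) (2 * β + 1) i k : R) =
      (-1) ^ k * ((-1) ^ β * (rhoPrime p α * rhoPrime p β) * evenOddValue p α β i k) := by
  rw [closedForm_eq]
  simp only [odd_spec, even_spec, lengthOf, lambda2, lambda3, lambda4, phiOf, nuOf, gamma2, gamma3,
    evenOddValue, evenOddExponent, mul_qDiff_mul_qInt, zPow_eq, qPow_eq, and_true, and_self,
    if_true, if_false, ← mul_assoc, ← pPow_add]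
  push_cast
  ring_nf

theorem closedForm_odd_even (p : Rˣ) (α β : ℕ) (i : ZMod 3) (k : ℕ) :
    (closedForm p (2 * α + 1) (2 * β + 2) i k : R) =
      (-1) ^ k * ((-1) ^ β * (rhoPrime p α * rhoPrime p β) * oddEvenValue p α β i k) := by
  rw [closedForm_eq]
  rcases zmod_three_cases i with rfl | rfl | rfl <;>
    simp only [odd_spec, even_spec, lengthOf, lambda2, lambda3, lambda4, phiOf, nuOf, gamma2,
      gamma3, oddEvenValue, mul_qDiff_mul_qInt, zmod_three_ne, zPow_eq, qPow_eq, and_false,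
      and_self, if_true, if_false, qSub, mul_one, mul_sub, sub_mul, ← mul_assoc, ← pPow_add] <;>
    push_cast <;>
    ring_nf

theorem closedForm_even_even (p : Rˣ) (α β : ℕ) (i : ZMod 3) (k : ℕ) :
    (closedForm p (2 * α + 2) (2 * β + 2) i k : R) =
      (-1) ^ k * ((-1) ^ β * (rhoPrime p α * rhoPrime p β) * evenEvenValue p α β i k) := by
  rw [closedForm_eq]
  rcases zmod_three_cases i with rfl | rfl | rfl <;>
    simp only [even_spec, lengthOf, lambda2, lambda3, lambda4, phiOf, nuOf, gamma2,
      gamma3, evenEvenValue, mul_qDiff_sq_mul_qInt, zmod_three_ne, zPow_eq, qPow_eq, and_false,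
      false_and, and_self, if_true, if_false, qSub, mul_one, mul_sub, sub_mul, ← mul_assoc,
      ← pPow_add] <;>
    push_cast <;>
    ring_nf

end ClosedForm

/-! ### The inductions on a and b. -/

section MainTheorem

variable {R : Type*} [CommRing R]

theorem rhoPrime_succ (p : Rˣ) (d : ℕ) :
    (rhoPrime p (d + 1) : R) = rhoPrime p d * (1 - pPow p (6 * (d + 1))) := by
  rw [rhoPrime, Finset.prod_Icc_succ_top (by omega), rhoPrime, qPow_eq]
  push_cast
  ring_nf

theorem rhoPrime_zero (p : Rˣ) : (rhoPrime p 0 : R) = 1 := by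
  simp [rhoPrime]

/-- The two parities of a are proved together, as each feeds the next. -/
theorem hasXiValues_baseOdd (p : Rˣ) (α : ℕ) :
    HasXiValues p (2 * α + 1) 0 (rhoPrime p α) (baseOddValue (R := R) p α) (baseOddEdge p α) ∧
      HasXiValues p (2 * α + 2) 0 (rhoPrime p α) (baseEvenValue (R := R) p α)
        (baseEvenEdge p α) := by
  have even {α : ℕ} (h : HasXiValues p (2 * α + 1) 0 (rhoPrime p α) (baseOddValue (R := R) p α)
      (baseOddEdge p α)) : HasXiValues p (2 * α + 2) 0 (rhoPrime p α) (baseEvenValue (R := R) p α)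
        (baseEvenEdge p α) :=
    h.base_succ (L := 2 * α + 2) (mod_cast xiStep_baseEven p α) rfl
      (Even.neg_one_pow ⟨α + 1, by ring⟩) (mul_one _)
  induction α with
  | zero =>
    refine (fun h => ⟨h, even h⟩) ?_
    have h0 := hasXiValues_zero_zero p fun i k => if i = 1 then baseOddValue (R := R) p 0 2 k else 0
    exact h0.base_succ (L := 1) (mod_cast xiStep_baseOdd_zero p) rfl
      (pow_one _) (by rw [rhoPrime_zero, mul_one])
  | succ α ih =>
    refine (fun h => ⟨h, even h⟩) ?_
    exact ih.2.base_succ (L := 2 * α + 3) (mod_cast xiStep_baseOdd_succ p α) rfl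
      (Odd.neg_one_pow ⟨α + 1, by ring⟩) (rhoPrime_succ p α).symm

theorem HasXiValues.oddEven {p : Rˣ} {α β : ℕ} {c : R}
    (h : HasXiValues p (2 * α + 1) (2 * β + 1) c (oddOddValue p α β) 0) :
    HasXiValues p (2 * α + 1) (2 * β + 2) c (oddEvenValue p α β)
      (-(pPow p (-2) * oddEvenValue p α β 1 1)) :=
  h.succ (L := 2 * α + 2 * β + 3) (mod_cast xiStep_oddEven p α β) (by ring)
    (Odd.neg_one_pow ⟨α + β + 1, by ring⟩) (mul_one c)

theorem HasXiValues.evenEven {p : Rˣ} {α β : ℕ} {c : R}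
    (h : HasXiValues p (2 * α + 2) (2 * β + 1) c (evenOddValue p α β) 0) :
    HasXiValues p (2 * α + 2) (2 * β + 2) c (evenEvenValue p α β)
      (-(pPow p (-2) * evenEvenValue p α β 1 1)) :=
  h.succ (L := 2 * α + 2 * β + 4) (mod_cast xiStep_evenEven p α β) (by ring)
    (Even.neg_one_pow ⟨α + β + 2, by ring⟩) (mul_one c)

theorem hasXiValues_oddOdd (p : Rˣ) (α β : ℕ) :
    HasXiValues p (2 * α + 1) (2 * β + 1) ((-1) ^ β * (rhoPrime p α * rhoPrime p β))
      (oddOddValue (R := R) p α β) 0 := by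
  induction β with
  | zero =>
    exact (hasXiValues_baseOdd p α).1.succ (L := 2 * α + 2) (mod_cast xiStep_oddOdd_zero p α) rfl
      (Even.neg_one_pow ⟨α + 1, by ring⟩) (by simp [rhoPrime])
  | succ β ih =>
    exact ih.oddEven.succ (L := 2 * α + 2 * β + 4) (mod_cast xiStep_oddOdd_succ p α β) (by ring)
      (Even.neg_one_pow ⟨α + β + 2, by ring⟩) (by rw [rhoPrime_succ]; ring)

theorem hasXiValues_evenOdd (p : Rˣ) (α β : ℕ) :
    HasXiValues p (2 * α + 2) (2 * β + 1) ((-1) ^ β * (rhoPrime p α * rhoPrime p β))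
      (evenOddValue (R := R) p α β) 0 := by
  induction β with
  | zero =>
    exact (hasXiValues_baseOdd p α).2.succ (L := 2 * α + 3) (mod_cast xiStep_evenOdd_zero p α) rfl
      (Odd.neg_one_pow ⟨α + 1, by ring⟩) (by simp [rhoPrime])
  | succ β ih =>
    exact ih.evenEven.succ (L := 2 * α + 2 * β + 5) (mod_cast xiStep_evenOdd_succ p α β) (by ring)
      (Odd.neg_one_pow ⟨α + β + 2, by ring⟩) (by rw [rhoPrime_succ]; push_cast; ring)

end MainTheorem

/-- The closed formula for `Ξ(a, b, i, k)` in the standard regime, over an arbitrary commutative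
ring with an invertible element `p`, where `z = p ^ 2` and `q = p ^ (-3)`. -/
theorem mainTheorem1 {R : Type*} [CommRing R] (p : Rˣ) (a b : ℕ) (ha : 0 < a) (hb : 0 < b)
    (i : ZMod 3) (k : ℕ) (hk0 : 0 < k) (hkl : k < a + b + 1) :
    (Xi (zOf p) a b i k : R) =
      mu b k * gamma1 p a b * gamma2 p a b i k * gamma3 p a b i k *
        kappa1 p a b k * kappa2 p i k *
        lambda1 p a b * lambda2 p a b * lambda3 p a b * lambda4 p a b * lambda5 p a b i := by
  change Xi (zOf p) a b i k = closedForm p a b i k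
  rcases halfPart_spec a ha with h1 | h1 <;> rcases halfPart_spec b hb with h2 | h2 <;>
    rw [h1, h2] at hkl ⊢
  · rw [closedForm_odd_odd, (hasXiValues_oddOdd p _ _).1 i k hk0 hkl]
  · rw [closedForm_odd_even, (hasXiValues_oddOdd p _ _).oddEven.1 i k hk0 hkl]
  · rw [closedForm_even_odd, (hasXiValues_evenOdd p _ _).1 i k hk0 hkl]
  · rw [closedForm_even_even, (hasXiValues_evenOdd p _ _).evenEven.1 i k hk0 hkl]
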